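/- **Setting.** Let $K$ be a field, complete for a discrete valuation $\mathrm{val}\colon K\to\mathbb Z\cup\{+\infty\}$, let $\pi\in K$ with $\mathrm{val}(\pi)=1$, and let $K^\circ$ be its ring of elements of nonnegative valuation. Let $K\{X\}^\circ$ be the ring of power series $\sum_{i\in\mathbb N^n}a_iX^i$ in $X=(X_1,\dots,X_n)$ with $a_i\in K^\circ$ and $\mathrm{val}(a_i)\to+\infty$; put $\mathrm{val}(\sum a_iX^i)=\min_i\mathrm{val}(a_i)$. Fix a monomial order $\le_\omega$ on $\mathbb N^n$. Let $T^\circ$ be the monoid of terms $aX^i$ with $a\in K^\circ\setminus\{0\}$, $i\in\mathbb N^n$, preordered by $aX^i\le bX^j$ iff $\mathrm{val}(a)>\mathrm{val}(b)$, or $\mathrm{val}(a)=\mathrm{val}(b)$ and $i\le_\omega j$; divisibility of terms is divisibility in $T^\circ$. The leading term $LT(f)$ of $f\ne0$ is its greatest term. For an ideal $I$ of $K\{X\}^\circ$, put $LT(I)=\{LT(f): f\in I, f\neq 0\}$, and let $\mathrm{Skel}(LT(I))$ be the set of elements of the image of $LT(I)$ in $T^\circ/(K^\circ)^\times$ that are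 minimal for divisibility (equivalently, the smallest subset generating this image as a monoid ideal). A finite family $(g_i)$ of elements of $I$ is a Gröbner basis of $I$ if the leading terms of its nonzero members generate $LT(I)$ as an ideal of $T^\circ$. Finally $\gcd(aX^i,bX^j)=\pi^{\min(\mathrm{val}(a),\mathrm{val}(b))}X^{\inf(i,j)}$. **Finite precision.** An approximate series $F=f+O(\pi^p)$ is a class of $f\in K\{X\}^\circ$ modulo series of valuation $\ge p$; a computation may use any representative, and may round any result within its precision. $F$ vanishes if $\mathrm{val}(f)\ge p$; otherwise $LT(F)$ denotes $LT(f)$, whose exponent and valuation depend only on $F$ and whose coefficient is known modulo $\pi^p$. Precision is propagated by the usual rules: a sum or difference has the smaller of the two precisions; $(x+O(\pi^p))(y+O(\pi^q))$ has precision $\min(\mathrm{val}(x)+q,\ \mathrm{val}(y)+p,\ p+q)$; multiplication by an exact term $t$ adds $\mathrm{val}(t)$ to the precision. **Algorithm.** The input is a family $F_1,\dots,F_m$ of approximate series. 1. Start with the list $G=(F_1,\dots,F_m)$ and the collection $B$ of pairs $(F_i,F_j)$, $i<j$. 2. While $B\neq\emptyset$, remove some pair $(f,g)$ from $B$. If $f$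 or $g$ vanishes, drop the pair. Otherwise put $d=\gcd(LT(f),LT(g))$ and divide the S-polynomial $h=\frac{LT(g)}{d}f-\frac{LT(f)}{d}g$ by $G$, as follows, starting with $r=0$. - While $h$ does not vanish: if $LT(g')\mid LT(h)$ for some non-vanishing $g'\in G$, choose such a $g'$ and an exact term $q\in T^\circ$ such that $LT(h)=q\,LT(g')$ at the working precision (the smaller of the precision of $h$ and that of $q\,g'$), and replace $h$ by $h-q\,g'$. If there is no such $g'$, replace $r$ by $r+LT(h)$ and $h$ by $h-LT(h)$, the precision of $h$ being unchanged. - When $h$ vanishes, with precision $p$, the remainder is $R=r+O(\pi^p)$. If $R$ does not vanish, add to $B$ the pairs $(g',R)$ for $g'\in G$, then append $R$ to $G$. 3. When $B=\emptyset$, return $G$. **Theorem.** Let $I$ be an ideal of $K\{X\}^\circ$, generated by $f_1,\dots,f_m$, and let $N$ be an integer such that $N>\mathrm{val}(t)$ for every $t\in\mathrm{Skel}(LT(I))$. Call the algorithm with $f_1+O(\pi^N),\dots,f_m+O(\pi^N)$. Then, whatever representatives, roundings and choices (of pairs, divisors, exact quotient terms) are used, it terminates after finitely many steps, is never blocked before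 returning a result, and returns $G=(g_1,\dots,g_s)$ such that: 1. each $g_i$ is known at precision at least $O(\pi^N)$; 2. $G$ is the approximation of an actual Gröbner basis of $I$: there is a Gröbner basis $(\hat g_1,\dots,\hat g_s)$ of $I$ such that, for every $i$, $\hat g_i$ belongs to the class $g_i$ (that is, $g_i=\hat g_i+O(\pi^{p_i})$, where $p_i$ is the precision of $g_i$). -/

import Mathlib

namespace TateGB

noncomputable section

/-- The field `K` is complete for the distance defined by the valuation `v`: every Cauchy sequence
converges. -/
def IsCompleteFor {K : Type*} [Field K] (v : AddValuation K (WithTop ℤ)) : Prop :=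
  ∀ u : ℕ → K,
    (∀ M : ℤ, ∃ k₀ : ℕ, ∀ k ≥ k₀, ∀ l ≥ k₀, (M : WithTop ℤ) ≤ v (u k - u l)) →
    ∃ x : K, ∀ M : ℤ, ∃ k₀ : ℕ, ∀ k ≥ k₀, (M : WithTop ℤ) ≤ v (u k - x)

/-! ### The integral Tate algebra -/

/-- The integral Tate algebra `K{X}°` (log-radii zero): the power series whose coefficients have
valuation tending to `+∞` (for each `M`, only finitely many coefficients have valuation `< M`) and
whose Gauss valuation is nonnegative (all coefficients have nonnegative valuation). -/
def IntTate {K : Type*} [Field K] (v : AddValuation K (WithTop ℤ)) (n : ℕ) :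
    Subring (MvPowerSeries (Fin n) K) where
  carrier := {f | (∀ M : ℤ, {i | v (MvPowerSeries.coeff i f) < (M : WithTop ℤ)}.Finite) ∧
    ∀ i, 0 ≤ v (MvPowerSeries.coeff i f)}
  zero_mem' := by
    refine ⟨fun M => ?_, fun i => by simp⟩
    simp
  one_mem' := by
    classical
    refine ⟨fun M => ?_, fun i => ?_⟩
    · refine (Set.finite_singleton (0 : Fin n →₀ ℕ)).subset fun i hi => ?_
      by_contra h
      have h' : i ≠ 0 := h
      simp [MvPowerSeries.coeff_one, h'] at hi
    · rw [MvPowerSeries.coeff_one]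
      split_ifs <;> simp
  add_mem' := by
    rintro f g ⟨hf, hf0⟩ ⟨hg, hg0⟩
    refine ⟨fun M => ((hf M).union (hg M)).subset fun i hi => ?_, fun i => ?_⟩
    · by_contra h
      simp only [Set.mem_union, Set.mem_ofPred_eq, not_or, not_lt] at h
      have hi' : v (MvPowerSeries.coeff i (f + g)) < (M : WithTop ℤ) := hi
      rw [map_add] at hi'
      exact absurd (v.map_le_add h.1 h.2) (not_le.mpr hi')
    · rw [map_add]
      exact v.map_le_add (hf0 i) (hg0 i)
  neg_mem' := by
    rintro f ⟨hf, hf0⟩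
    refine ⟨fun M => ?_, fun i => ?_⟩
    · simpa [AddValuation.map_neg] using hf M
    · simpa [AddValuation.map_neg] using hf0 i
  mul_mem' := by
    classical
    rintro f g ⟨hf, hf0⟩ ⟨hg, hg0⟩
    refine ⟨fun M => ((hf M).add (hg M)).subset fun i hi => ?_, fun i => ?_⟩
    · by_contra h
      have hi' : v (MvPowerSeries.coeff i (f * g)) < (M : WithTop ℤ) := hi
      rw [MvPowerSeries.coeff_mul] at hi'
      refine absurd (v.map_le_sum fun p hp => ?_) (not_le.mpr hi')
      rw [v.map_mul]
      by_cases h1 : v (MvPowerSeries.coeff p.1 f) < (M : WithTop ℤ)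
      · by_cases h2 : v (MvPowerSeries.coeff p.2 g) < (M : WithTop ℤ)
        · exact absurd (Set.mem_add.mpr ⟨p.1, h1, p.2, h2, Finset.HasAntidiagonal.mem_antidiagonal.mp hp⟩) h
        · exact (not_lt.mp h2).trans (le_add_of_nonneg_left (hf0 _))
      · exact (not_lt.mp h1).trans (le_add_of_nonneg_right (hg0 _))
    · rw [MvPowerSeries.coeff_mul]
      refine v.map_le_sum fun p _ => ?_
      rw [v.map_mul]
      exact add_nonneg (hf0 _) (hg0 _)

/-- `x = y + O(π ^ p)`. -/
def Cong {K : Type*} [Field K] (v : AddValuation K (WithTop ℤ)) {n : ℕ} (p : ℤ)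
    (x y : MvPowerSeries (Fin n) K) : Prop :=
  ∀ i, (p : WithTop ℤ) ≤ v (MvPowerSeries.coeff i (x - y))

/-! ### Terms -/

/-- The integer valuation of a nonzero element of `K`. -/
def ord {K : Type*} [Field K] (v : AddValuation K (WithTop ℤ)) (a : Kˣ) : ℤ :=
  (v (a : K)).untop (v.ne_top_iff.mpr a.ne_zero)

theorem coe_ord {K : Type*} [Field K] (v : AddValuation K (WithTop ℤ)) (a : Kˣ) :
    (ord v a : WithTop ℤ) = v (a : K) :=
  WithTop.coe_untop _ _

theorem ord_one {K : Type*} [Field K] (v : AddValuation K (WithTop ℤ)) : ord v 1 = 0 := by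
  have h := coe_ord v 1
  rw [Units.val_one, v.map_one] at h
  exact_mod_cast h

theorem ord_mul {K : Type*} [Field K] (v : AddValuation K (WithTop ℤ)) (a b : Kˣ) :
    ord v (a * b) = ord v a + ord v b := by
  have h := coe_ord v (a * b)
  rw [Units.val_mul, v.map_mul, ← coe_ord, ← coe_ord] at h
  exact_mod_cast h

/-- The monoid of terms `a X ^ i`, with `a ∈ Kˣ` and `i ∈ ℕ ^ n`. -/
abbrev Term (K : Type*) [Field K] (n : ℕ) : Type _ :=
  Kˣ × Multiplicative (Fin n →₀ ℕ)

/-- The exponent of a term. -/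
def Term.exp {K : Type*} [Field K] {n : ℕ} (t : Term K n) : Fin n →₀ ℕ :=
  Multiplicative.toAdd t.2

/-- The valuation of a term. -/
def Term.val {K : Type*} [Field K] (v : AddValuation K (WithTop ℤ)) {n : ℕ} (t : Term K n) : ℤ :=
  ord v t.1

/-- A term, seen as a power series. -/
def Term.toSeries {K : Type*} [Field K] {n : ℕ} (t : Term K n) : MvPowerSeries (Fin n) K :=
  MvPowerSeries.monomial t.exp (t.1 : K)

/-- The preorder on terms: `s ≤ t` iff `val s > val t`, or `val s = val t` and the exponent of `s`
is at most that of `t` for the monomial order. -/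
def Term.Le {K : Type*} [Field K] (v : AddValuation K (WithTop ℤ)) {n : ℕ}
    (mo : MonomialOrder (Fin n)) (s t : Term K n) : Prop :=
  t.val v < s.val v ∨ s.val v = t.val v ∧ mo.toSyn s.exp ≤ mo.toSyn t.exp

/-- `gcd (a X ^ i, b X ^ j) = π ^ min (val a) (val b) X ^ inf (i, j)`. -/
def Term.gcd {K : Type*} [Field K] (v : AddValuation K (WithTop ℤ)) (π : Kˣ) {n : ℕ}
    (s t : Term K n) : Term K n :=
  (π ^ min (s.val v) (t.val v), Multiplicative.ofAdd (s.exp ⊓ t.exp))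

/-- The monoid of integral terms: the terms of nonnegative valuation. Divisibility between integral
terms is always taken in this monoid. -/
def IntTerm {K : Type*} [Field K] (v : AddValuation K (WithTop ℤ)) (n : ℕ) :
    Submonoid (Term K n) where
  carrier := {t | 0 ≤ t.val v}
  one_mem' := (ord_one v).ge
  mul_mem' := fun {s t} hs ht => (add_nonneg hs ht).trans (ord_mul v s.1 t.1).ge

/-! ### Ideals of monoids and skeletons -/

/-- A (possibly empty) ideal of a commutative monoid. -/
def IsMonoidIdeal {M : Type*} [CommMonoid M] (J : Set M) : Prop :=
  ∀ a : M, ∀ x ∈ J, a * x ∈ J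

/-- The ideal of a commutative monoid generated by a subset. -/
def monoidSpan {M : Type*} [CommMonoid M] (S : Set M) : Set M :=
  {t | ∃ s ∈ S, s ∣ t}

/-- The skeleton of an ideal of a monoid `M`: the minimal elements, for divisibility, of its image
in the quotient `Associates M` of `M` by its group of units. For integral terms it is
the smallest generating subset of this image: see `skeleton_generates` and `skeleton_subset`. -/
def skeleton {M : Type*} [CommMonoid M] (J : Set M) : Set (Associates M) :=
  {a | Minimal (· ∈ Associates.mk '' J) a}

/-- The leading term of a nonzero series `f`: the greatest of its terms. No term is the leading
term of `0`. -/
def IsLeadingTerm {K : Type*} [Field K] (v : AddValuation K (WithTop ℤ)) {n : ℕ}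
    (mo : MonomialOrder (Fin n)) (f : IntTate v n) (t : IntTerm v n) : Prop :=
  MvPowerSeries.coeff t.1.exp f.1 = (t.1.1 : K) ∧
    ∀ s : Term K n, MvPowerSeries.coeff s.exp f.1 = (s.1 : K) → s.Le v mo t.1

/-- `LT(I)`: the set of leading terms of nonzero elements of an ideal. -/
def leadingTerms {K : Type*} [Field K] (v : AddValuation K (WithTop ℤ)) {n : ℕ}
    (mo : MonomialOrder (Fin n)) (I : Ideal (IntTate v n)) : Set (IntTerm v n) :=
  {t | ∃ f ∈ I, IsLeadingTerm v mo f t}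

/-- A family `g` is a Gröbner basis of `I`: its members lie in `I` and the leading terms of the
nonzero members generate `LT(I)` in the monoid of integral terms. -/
def IsGroebnerBasis {K : Type*} [Field K] (v : AddValuation K (WithTop ℤ)) {n : ℕ}
    (mo : MonomialOrder (Fin n)) (I : Ideal (IntTate v n)) {ι : Type*} (g : ι → IntTate v n) :
    Prop :=
  (∀ i, g i ∈ I) ∧ leadingTerms v mo I = monoidSpan {t | ∃ i, IsLeadingTerm v mo (g i) t}

/-! ### Finite precision -/

/-- A series known at finite precision, `center + O(π ^ prec)`. Two pairs with the same precision
and congruent centers stand for the same approximate series. -/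
structure Approx {K : Type*} [Field K] (v : AddValuation K (WithTop ℤ)) (n : ℕ) where
  center : IntTate v n
  prec : ℤ

/-- `F` is a representation of `x + O(π ^ p)`. The center of `F` need not be `x`: every result of
a computation may be rounded arbitrarily within its precision. -/
def Approx.Represents {K : Type*} [Field K] {v : AddValuation K (WithTop ℤ)} {n : ℕ}
    (F : Approx v n) (x : MvPowerSeries (Fin n) K) (p : ℤ) : Prop :=
  F.prec = p ∧ Cong v p F.center.1 x

/-- `F` is zero at its precision. -/
def Approx.Vanishes {K : Type*} [Field K] {v : AddValuation K (WithTop ℤ)} {n : ℕ}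
    (F : Approx v n) : Prop :=
  Cong v F.prec F.center.1 0

/-- `t` is the leading term of an approximate series that is not zero at its precision. Its
exponent and valuation are determined by `F`, its coefficient is known modulo `π ^ F.prec`. -/
def Approx.IsLT {K : Type*} [Field K] {v : AddValuation K (WithTop ℤ)} {n : ℕ}
    (mo : MonomialOrder (Fin n)) (F : Approx v n) (t : IntTerm v n) : Prop :=
  ¬ F.Vanishes ∧ IsLeadingTerm v mo F.center t

/-- The precision of the product `(x + O(π ^ p)) (y + O(π ^ q))`, where `val x = α` and
`val y = β`. -/
def mulPrec (α p β q : ℤ) : ℤ :=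
  min (min (α + q) (β + p)) (p + q)

/-- `H` is the S-polynomial `(LT(G) / d) F - (LT(F) / d) G` of `F` and `G`, with
`d = gcd (LT(F), LT(G))` exact, at the precision given by the rules of `O`-arithmetic: the
coefficient of `LT(G) / d` is known at precision `G.prec - val d`, that of `LT(F) / d` at precision
`F.prec - val d`. -/
def IsSPoly {K : Type*} [Field K] {v : AddValuation K (WithTop ℤ)} {n : ℕ} (π : Kˣ)
    (mo : MonomialOrder (Fin n)) (F G H : Approx v n) : Prop :=
  ∃ (s t : IntTerm v n) (a b : Term K n), F.IsLT mo s ∧ G.IsLT mo t ∧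
    a * Term.gcd v π s.1 t.1 = t.1 ∧ b * Term.gcd v π s.1 t.1 = s.1 ∧
    H.Represents (a.toSeries * F.center.1 - b.toSeries * G.center.1)
      (min
        (mulPrec (a.val v) (G.prec - (Term.gcd v π s.1 t.1).val v) (s.1.val v) F.prec)
        (mulPrec (b.val v) (F.prec - (Term.gcd v π s.1 t.1).val v) (t.1.val v) G.prec))

/-! ### Buchberger's algorithm at finite precision -/

/-- The states of the algorithm: the main loop, with the current basis and the remaining pairs;
the division loop called from it, with the current dividend and remainder; and the end. -/
inductive State {K : Type*} [Field K] (v : AddValuation K (WithTop ℤ)) (n : ℕ) where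
  | main (G : List (Approx v n)) (B : Multiset (Approx v n × Approx v n))
  | division (G : List (Approx v n)) (B : Multiset (Approx v n × Approx v n))
      (h : Approx v n) (r : IntTate v n)
  | output (G : List (Approx v n))

/-- The initial state: `G = (F_1, ..., F_m)` and `B = {(F_i, F_j), i < j}`. -/
def State.init {K : Type*} [Field K] {v : AddValuation K (WithTop ℤ)} {n m : ℕ}
    (F : Fin m → Approx v n) : State v n :=
  .main (List.ofFn F)
    ((Finset.univ.filter fun p : Fin m × Fin m => p.1 < p.2).val.map fun p => (F p.1, F p.2))

/-- One step of Buchberger's algorithm. All choices of the algorithm (next pair, divisor, exact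
quotient term, rounding) are left free. -/
inductive Step {K : Type*} [Field K] {v : AddValuation K (WithTop ℤ)} {n : ℕ} (π : Kˣ)
    (mo : MonomialOrder (Fin n)) : State v n → State v n → Prop
  /-- A pair with a member that is zero at its precision has no S-polynomial: it is dropped. -/
  | skip {G : List (Approx v n)} {B : Multiset (Approx v n × Approx v n)} {f g : Approx v n}
      (hfg : f.Vanishes ∨ g.Vanishes) :
      Step π mo (.main G ((f, g) ::ₘ B)) (.main G B)
  /-- Take a pair out of `B`, form its S-polynomial `h` and start dividing it by `G`. -/
  | spoly {G : List (Approx v n)} {B : Multiset (Approx v n × Approx v n)} {f g h : Approx v n}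
      (hh : IsSPoly π mo f g h) :
      Step π mo (.main G ((f, g) ::ₘ B)) (.division G B h 0)
  /-- If `LT(g)` divides `LT(h)`, choose an exact term `q` such that `LT(h) = q LT(g)` at the
  working precision and replace `h` by `h - q g`. -/
  | reduce {G : List (Approx v n)} {B : Multiset (Approx v n × Approx v n)}
      {h h' g : Approx v n} {r : IntTate v n} {s t q : IntTerm v n}
      (hg : g ∈ G) (ht : h.IsLT mo t) (hs : g.IsLT mo s) (hst : s ∣ t)
      (hq : Cong v (min h.prec (g.prec + q.1.val v)) t.1.toSeries (q * s).1.toSeries)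
      (hh' : h'.Represents (h.center.1 - q.1.toSeries * g.center.1)
        (min h.prec (g.prec + q.1.val v))) :
      Step π mo (.division G B h r) (.division G B h' r)
  /-- If no leading term of `G` divides `LT(h)`, move `LT(h)` from `h` to the remainder. -/
  | move {G : List (Approx v n)} {B : Multiset (Approx v n × Approx v n)}
      {h h' : Approx v n} {r r' : IntTate v n} {t : IntTerm v n}
      (ht : h.IsLT mo t) (hG : ∀ g ∈ G, ∀ s : IntTerm v n, g.IsLT mo s → ¬ s ∣ t)
      (hr' : Cong v h.prec r'.1 (r.1 + t.1.toSeries))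
      (hh' : h'.Represents (h.center.1 - t.1.toSeries) h.prec) :
      Step π mo (.division G B h r) (.division G B h' r')
  /-- The division is over when `h` is zero at its precision `p`; its remainder is
  `R = r + O(π ^ p)`. If it is zero, return to the main loop. -/
  | discard {G : List (Approx v n)} {B : Multiset (Approx v n × Approx v n)}
      {h R : Approx v n} {r : IntTate v n}
      (hh : h.Vanishes) (hR : R.Represents r.1 h.prec) (hR0 : R.Vanishes) :
      Step π mo (.division G B h r) (.main G B)
  /-- If the remainder `R` is not zero, add it to `G` and the pairs `(g, R)`, `g ∈ G`, to `B`. -/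
  | adjoin {G : List (Approx v n)} {B : Multiset (Approx v n × Approx v n)}
      {h R : Approx v n} {r : IntTate v n}
      (hh : h.Vanishes) (hR : R.Represents r.1 h.prec) (hR0 : ¬ R.Vanishes) :
      Step π mo (.division G B h r)
        (.main (G ++ [R]) (B + ((G.map fun g => (g, R) : List (Approx v n × Approx v n)) :
          Multiset (Approx v n × Approx v n))))
  /-- No pair is left: return `G`. -/
  | finish {G : List (Approx v n)} : Step π mo (.main G 0) (.output G)

/-! ### The skeleton is the smallest generating subset -/

theorem skeleton_generates {K : Type*} [Field K] (v : AddValuation K (WithTop ℤ)) (n : ℕ)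
    (J : Set (IntTerm v n)) (hJ : IsMonoidIdeal J) :
    monoidSpan (skeleton J) = Associates.mk '' J := by
  ext a
  constructor
  · rintro ⟨s, hs, c, rfl⟩
    obtain ⟨x, hx, rfl⟩ := hs.1
    obtain ⟨c, rfl⟩ := Associates.mk_surjective c
    exact ⟨c * x, hJ c x hx, by rw [mul_comm, Associates.mk_mul_mk]⟩
  · rintro ⟨t, ht, rfl⟩
    have key : ∀ k : ℕ, ∀ t ∈ J, (t.1.val v).toNat + t.1.exp.degree ≤ k →
        Associates.mk t ∈ monoidSpan (skeleton J) := by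
      intro k
      induction k using Nat.strong_induction_on with
      | _ k ih =>
        intro t ht hk
        by_cases hmin : Associates.mk t ∈ skeleton J
        · exact ⟨_, hmin, dvd_rfl⟩
        · have hex : ∃ s ∈ J, s ∣ t ∧ ¬ t ∣ s := by
            by_contra hcon
            push Not at hcon
            refine hmin ⟨⟨t, ht, rfl⟩, ?_⟩
            rintro _ ⟨s, hs, rfl⟩ hle
            exact Associates.mk_le_mk_iff_dvd.mpr
              (hcon s hs (Associates.mk_le_mk_iff_dvd.mp hle))
          obtain ⟨s, hs, ⟨c, rfl⟩, hnd⟩ := hex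
          have hc0 : 0 ≤ c.1.val v := c.2
          have hs0 : 0 ≤ s.1.val v := s.2
          have hval : (s * c).1.val v = s.1.val v + c.1.val v := ord_mul v s.1.1 c.1.1
          have hexp : (s * c).1.exp = s.1.exp + c.1.exp := rfl
          have hpos : 0 < (c.1.val v).toNat + c.1.exp.degree := by
            by_contra h0
            have h1 : c.1.val v = 0 := by omega
            have h2 : c.1.exp.degree = 0 := by omega
            have h3 : c.1.exp = 0 := (Finsupp.degree_eq_zero_iff _).mp h2
            have hinv : ord v (c.1.1)⁻¹ = 0 := by
              have h4 := ord_mul v c.1.1 (c.1.1)⁻¹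
              rw [mul_inv_cancel, ord_one] at h4
              have h5 : ord v c.1.1 = 0 := h1
              omega
            refine hnd ⟨⟨((c.1.1)⁻¹, 1), hinv.ge⟩, ?_⟩
            have h6 : c.1.2 = 1 := h3
            refine Subtype.ext (Prod.ext ?_ ?_)
            · simp
            · simp [h6]
          have hdeg : (s * c).1.exp.degree = s.1.exp.degree + c.1.exp.degree := by
            rw [hexp, map_add]
          obtain ⟨a, ha, hd⟩ := ih ((s.1.val v).toNat + s.1.exp.degree) (by omega) s hs le_rfl
          exact ⟨a, ha, hd.trans (Associates.mk_dvd_mk.mpr (dvd_mul_right s c))⟩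
    exact key _ t ht le_rfl

theorem skeleton_subset {K : Type*} [Field K] (v : AddValuation K (WithTop ℤ)) (n : ℕ)
    (J : Set (IntTerm v n)) (S : Set (Associates (IntTerm v n)))
    (hS : monoidSpan S = Associates.mk '' J) : skeleton J ⊆ S := by
  intro a ha
  have ha' : a ∈ monoidSpan S := hS ▸ ha.1
  obtain ⟨s, hs, hsa⟩ := ha'
  have hsJ : s ∈ Associates.mk '' J := hS ▸ (⟨s, hs, dvd_rfl⟩ : s ∈ monoidSpan S)
  have has : a ∣ s := ha.2 hsJ hsa
  obtain ⟨x, rfl⟩ := Associates.mk_surjective a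
  obtain ⟨y, rfl⟩ := Associates.mk_surjective s
  obtain ⟨c, hc⟩ := Associates.mk_dvd_mk.mp hsa
  obtain ⟨d, hd⟩ := Associates.mk_dvd_mk.mp has
  have hcd : c * d = 1 := by
    have h : y * (c * d) = y * 1 := by rw [← mul_assoc, ← hc, ← hd, mul_one]
    exact Subtype.ext (mul_left_cancel (congrArg Subtype.val h))
  have hxy : Associates.mk x = Associates.mk y :=
    Associates.mk_eq_mk_iff_associated.mpr
      ⟨⟨d, c, by rw [mul_comm, hcd], hcd⟩, by rw [hd]⟩
  rw [hxy]
  exact hs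

end

end TateGB

/-!
Everything is done with the centers of the approximate series, the leading terms being compared by
`Term.Lt`; `below γ` and `atMost γ` are the groups of series all of whose terms are smaller than,
or at most, the term `γ`, and `negligible n p` is the group of the series that are `O(π ^ p)`.

*The output is a Gröbner basis.* By `skeleton_generates`, `LT(I)` is generated by leading terms of
valuation less than `N`, so it is enough to know the members of the output modulo `O(π ^ N)`. The
group `combos mo N G P` consists of the sums, modulo `O(π ^ N)`, of multiples `q g` of members of
`G` such that `q LT(g)` satisfies `P`. Since an integral series is a polynomial modulo `O(π ^ N)`
and the input belongs to `G`, every element of `I` lies in such a group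
(`mem_combos_of_mem_span`). A pair is `Good` if the difference of any two multiples of its members
with the same leading term `γ` is a combination with leading terms smaller than `γ`. When all pairs
are good, all multiples with leading term `γ` are proportional up to smaller ones, hence a
combination whose leading terms are at most `γ`, and which is itself smaller than `γ`, can be
rewritten with smaller leading terms (`mem_combos_lt_of_mem_below`). Below valuation `N` the order
on terms is well founded, and Buchberger's criterion `exists_isLT_dvd` follows.

*The invariant.* All precisions remain at least `N` because the leading term of a nonvanishing
series has valuation less than its precision; all members of `G` remain congruent to elements of `I`
at their own precision; and the division of an S-polynomial writes it as a combination with leading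
terms smaller than the least common multiple, so that its pair becomes good (`good_of_spoly`,
`DivisionInvariant.good`). This is `State.Invariant.step`.

*Termination.* A division lowers the leading term of the dividend, whose valuation is bounded by
its precision (`acc_division`). The significant terms of the remainder are divisible by no leading
term of `G` (`RemainderInvariant`), so that each new member of `G` enlarges the upper set generated
by the exponents of the leading terms in `ℕ × ℕ ^ n`; by Dickson's lemma this happens finitely many
times (`acc_main`).
-/

namespace TateGB

/-! ### Terms and their order -/

section Terms

variable {K : Type*} [Field K] (v : AddValuation K (WithTop ℤ)) {n : ℕ} (mo : MonomialOrder (Fin n))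

/-- The strict order on terms: valuations are compared first, a smaller one giving a greater term,
and exponents next. -/
def Term.Lt (s t : Term K n) : Prop :=
  t.val v < s.val v ∨ s.val v = t.val v ∧ mo.toSyn s.exp < mo.toSyn t.exp

theorem Term.val_mul (s t : Term K n) : (s * t).val v = s.val v + t.val v :=
  ord_mul v s.1 t.1

theorem Term.exp_mul (s t : Term K n) : (s * t).exp = s.exp + t.exp := rfl

theorem Term.coe_val (t : Term K n) : (t.val v : WithTop ℤ) = v (t.1 : K) :=
  coe_ord v t.1

theorem IntTerm.val_nonneg (t : IntTerm v n) : 0 ≤ t.1.val v := t.2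

theorem Term.ext_of_coeff {s t : Term K n} (h₁ : (s.1 : K) = t.1) (h₂ : s.exp = t.exp) : s = t :=
  Prod.ext (Units.ext h₁) h₂

variable {v mo}

theorem Term.Lt.le {s t : Term K n} (h : s.Lt v mo t) : s.Le v mo t :=
  h.imp id fun h => ⟨h.1, h.2.le⟩

theorem Term.le_of_val_eq_of_exp_eq {s t : Term K n} (h₁ : s.val v = t.val v)
    (h₂ : s.exp = t.exp) : s.Le v mo t :=
  Or.inr ⟨h₁, by rw [h₂]⟩

theorem Term.Le.lt_or_eq {s t : Term K n} (h : s.Le v mo t) :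
    s.Lt v mo t ∨ s.val v = t.val v ∧ s.exp = t.exp := by
  rcases h with h | ⟨h₁, h₂⟩
  · exact Or.inl (Or.inl h)
  · rcases h₂.lt_or_eq with h₃ | h₃
    · exact Or.inl (Or.inr ⟨h₁, h₃⟩)
    · exact Or.inr ⟨h₁, mo.toSyn.injective h₃⟩

theorem Term.Le.trans_lt {s t u : Term K n} (h : s.Le v mo t) (h' : t.Lt v mo u) :
    s.Lt v mo u := by
  rcases h with h | ⟨h₁, h₂⟩ <;> rcases h' with h' | ⟨h₁', h₂'⟩
  · exact Or.inl (by omega)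
  · exact Or.inl (by omega)
  · exact Or.inl (by omega)
  · exact Or.inr ⟨by omega, h₂.trans_lt h₂'⟩

theorem Term.Lt.trans_le {s t u : Term K n} (h : s.Lt v mo t) (h' : t.Le v mo u) :
    s.Lt v mo u := by
  rcases h with h | ⟨h₁, h₂⟩ <;> rcases h' with h' | ⟨h₁', h₂'⟩
  · exact Or.inl (by omega)
  · exact Or.inl (by omega)
  · exact Or.inl (by omega)
  · exact Or.inr ⟨by omega, h₂.trans_le h₂'⟩

theorem Term.Lt.irrefl {s : Term K n} (h : s.Lt v mo s) : False := by
  rcases h with h | ⟨_, h⟩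
  · exact lt_irrefl _ h
  · exact lt_irrefl _ h

theorem Term.le_total (s t : Term K n) : s.Le v mo t ∨ t.Le v mo s := by
  rcases lt_trichotomy (s.val v) (t.val v) with h | h | h
  · exact Or.inr (Or.inl h)
  · rcases _root_.le_total (mo.toSyn s.exp) (mo.toSyn t.exp) with h' | h'
    · exact Or.inl (Or.inr ⟨h, h'⟩)
    · exact Or.inr (Or.inr ⟨h.symm, h'⟩)
  · exact Or.inl (Or.inl h)

theorem Term.Lt.mul_left {s t : Term K n} (h : s.Lt v mo t) (c : Term K n) :
    (c * s).Lt v mo (c * t) := by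
  simp only [Term.Lt, Term.val_mul, Term.exp_mul, map_add] at h ⊢
  rcases h with h | ⟨h₁, h₂⟩
  · exact Or.inl (by omega)
  · exact Or.inr ⟨by omega, by gcongr⟩

/-- Divisibility of integral terms is the componentwise order on valuations and exponents. -/
theorem IntTerm.dvd_iff {s t : IntTerm v n} :
    s ∣ t ↔ s.1.val v ≤ t.1.val v ∧ s.1.exp ≤ t.1.exp := by
  constructor
  · rintro ⟨c, rfl⟩
    have hc := IntTerm.val_nonneg v c
    refine ⟨?_, ?_⟩
    · change _ ≤ (s.1 * c.1).val v
      rw [Term.val_mul]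
      omega
    · change _ ≤ (s.1 * c.1).exp
      rw [Term.exp_mul]
      exact le_self_add
  · rintro ⟨h₁, h₂⟩
    have hval : ord v (t.1.1 / s.1.1) = ord v t.1.1 - ord v s.1.1 := by
      have := ord_mul v (t.1.1 / s.1.1) s.1.1
      rw [div_mul_cancel] at this
      omega
    refine ⟨⟨(t.1.1 / s.1.1, Multiplicative.ofAdd (t.1.exp - s.1.exp)), ?_⟩, ?_⟩
    · change 0 ≤ ord v (t.1.1 / s.1.1)
      rw [hval]
      exact sub_nonneg.mpr h₁
    · refine Subtype.ext (Prod.ext ?_ ?_)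
      · exact (mul_div_cancel _ _).symm
      · exact (add_tsub_cancel_of_le h₂).symm

variable (v mo)

/-- Below a given precision, the order on integral terms has no infinite descending chain. -/
theorem Term.wellFounded_lt_of_val_lt (N : ℤ) :
    WellFounded fun s t : Term K n => s.Lt v mo t ∧ s.val v < N ∧ t.val v < N := by
  refine Subrelation.wf (r := InvImage (Prod.Lex (· < ·) (· < ·))
    fun s : Term K n => ((N - s.val v).toNat, mo.toSyn s.exp)) ?_
    (InvImage.wf _ (WellFounded.prod_lex wellFounded_lt wellFounded_lt))
  rintro s t ⟨h | ⟨h₁, h₂⟩, hs, ht⟩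
  · exact Prod.Lex.left _ _ (by omega)
  · change Prod.Lex _ _ (_, _) (_, _)
    rw [h₁]
    exact Prod.Lex.right _ h₂

end Terms

/-! ### Series bounded by a term -/

section Bounds

variable {K : Type*} [Field K] (v : AddValuation K (WithTop ℤ)) {n : ℕ} (mo : MonomialOrder (Fin n))

/-- The series whose coefficients have valuation at least `e`, and greater than `e` at the
exponents in `S`. -/
def bounded (e : ℤ) (S : Set (Fin n →₀ ℕ)) : AddSubgroup (MvPowerSeries (Fin n) K) where
  carrier := {x | ∀ j, (e : WithTop ℤ) ≤ v (MvPowerSeries.coeff j x) ∧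
    (j ∈ S → (e : WithTop ℤ) < v (MvPowerSeries.coeff j x))}
  zero_mem' j := by simp
  add_mem' {x y} hx hy j := by
    rw [map_add]
    exact ⟨v.map_le_add (hx j).1 (hy j).1, fun h => v.map_lt_add ((hx j).2 h) ((hy j).2 h)⟩
  neg_mem' {x} hx j := by
    rw [map_neg, v.map_neg]
    exact hx j

/-- The series whose terms are all at most `γ`. -/
def atMost (γ : Term K n) : AddSubgroup (MvPowerSeries (Fin n) K) :=
  bounded v (γ.val v) {j | mo.toSyn γ.exp < mo.toSyn j}

/-- The series whose terms are all smaller than `γ`. -/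
def below (γ : Term K n) : AddSubgroup (MvPowerSeries (Fin n) K) :=
  bounded v (γ.val v) {j | mo.toSyn γ.exp ≤ mo.toSyn j}

/-- The series that vanish at precision `O(π ^ p)`. -/
def negligible (n : ℕ) (p : ℤ) : AddSubgroup (MvPowerSeries (Fin n) K) :=
  bounded v p ∅

variable {v mo}

theorem mem_bounded {e : ℤ} {S : Set (Fin n →₀ ℕ)} {x : MvPowerSeries (Fin n) K} :
    x ∈ bounded v e S ↔ ∀ j, (e : WithTop ℤ) ≤ v (MvPowerSeries.coeff j x) ∧
      (j ∈ S → (e : WithTop ℤ) < v (MvPowerSeries.coeff j x)) := Iff.rfl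

theorem mem_negligible {p : ℤ} {x : MvPowerSeries (Fin n) K} :
    x ∈ negligible v n p ↔ ∀ j, (p : WithTop ℤ) ≤ v (MvPowerSeries.coeff j x) := by
  simp [negligible, mem_bounded]

theorem cong_iff {p : ℤ} {x y : MvPowerSeries (Fin n) K} :
    Cong v p x y ↔ x - y ∈ negligible v n p := mem_negligible.symm

theorem Approx.vanishes_iff {F : Approx v n} :
    F.Vanishes ↔ F.center.1 ∈ negligible v n F.prec := by
  rw [Approx.Vanishes, cong_iff, sub_zero]

theorem negligible_mono {p q : ℤ} (h : p ≤ q) : negligible v n q ≤ negligible v n p := fun _ hx =>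
  mem_negligible.mpr fun j => (WithTop.coe_le_coe.mpr h).trans (mem_negligible.mp hx j)

theorem Cong.refl (p : ℤ) (x : MvPowerSeries (Fin n) K) : Cong v p x x := by
  rw [cong_iff, sub_self]
  exact zero_mem _

theorem Cong.symm {p : ℤ} {x y : MvPowerSeries (Fin n) K} (h : Cong v p x y) : Cong v p y x := by
  rw [cong_iff] at h ⊢
  rw [← neg_sub]
  exact neg_mem h

theorem Cong.trans {p : ℤ} {x y z : MvPowerSeries (Fin n) K} (h : Cong v p x y)
    (h' : Cong v p y z) : Cong v p x z := by
  rw [cong_iff] at h h' ⊢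
  simpa using add_mem h h'

theorem Cong.mono {p q : ℤ} {x y : MvPowerSeries (Fin n) K} (h : Cong v q x y) (hpq : p ≤ q) :
    Cong v p x y :=
  cong_iff.mpr (negligible_mono hpq (cong_iff.mp h))

theorem Cong.add {p : ℤ} {x y x' y' : MvPowerSeries (Fin n) K} (h : Cong v p x y)
    (h' : Cong v p x' y') : Cong v p (x + x') (y + y') := by
  rw [cong_iff] at h h' ⊢
  rw [add_sub_add_comm]
  exact add_mem h h'

theorem Cong.sub {p : ℤ} {x y x' y' : MvPowerSeries (Fin n) K} (h : Cong v p x y)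
    (h' : Cong v p x' y') : Cong v p (x - x') (y - y') := by
  rw [cong_iff] at h h' ⊢
  rw [sub_sub_sub_comm]
  exact sub_mem h h'

theorem bounded_mono {e e' : ℤ} {S S' : Set (Fin n →₀ ℕ)} (he : e ≤ e')
    (h : e = e' → S ⊆ S') : bounded v e' S' ≤ bounded v e S := by
  intro x hx j
  refine ⟨(WithTop.coe_le_coe.mpr he).trans (hx j).1, fun hj => ?_⟩
  rcases he.lt_or_eq with he | rfl
  · exact (WithTop.coe_lt_coe.mpr he).trans_le (hx j).1
  · exact (hx j).2 (h rfl hj)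

theorem atMost_le_below {γ γ' : Term K n} (h : γ.Lt v mo γ') : atMost v mo γ ≤ below v mo γ' := by
  rcases h with h | ⟨h₁, h₂⟩
  · exact bounded_mono h.le fun h' => absurd h' h.ne
  · exact bounded_mono h₁.ge fun _ j hj => h₂.trans_le hj

theorem atMost_mono {γ γ' : Term K n} (h : γ.Le v mo γ') : atMost v mo γ ≤ atMost v mo γ' := by
  rcases h with h | ⟨h₁, h₂⟩
  · exact bounded_mono h.le fun h' => absurd h' h.ne
  · exact bounded_mono h₁.ge fun _ j hj => h₂.trans_lt hj

theorem below_mono {γ γ' : Term K n} (h : γ.Le v mo γ') : below v mo γ ≤ below v mo γ' := by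
  rcases h with h | ⟨h₁, h₂⟩
  · exact bounded_mono h.le fun h' => absurd h' h.ne
  · exact bounded_mono h₁.ge fun _ j hj => h₂.trans hj

theorem below_le_atMost (γ : Term K n) : below v mo γ ≤ atMost v mo γ :=
  bounded_mono le_rfl fun _ _ hj => hj.le

theorem negligible_le_below {p : ℤ} {γ : Term K n} (h : γ.val v < p) :
    negligible v n p ≤ below v mo γ :=
  bounded_mono h.le fun h' => absurd h' h.ne

theorem mem_below_iff {γ : Term K n} {x : MvPowerSeries (Fin n) K} :
    x ∈ below v mo γ ↔
      x ∈ atMost v mo γ ∧ (γ.val v : WithTop ℤ) < v (MvPowerSeries.coeff γ.exp x) := by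
  refine ⟨fun h => ⟨below_le_atMost γ h, (h γ.exp).2 le_rfl⟩, fun h j => ⟨(h.1 j).1, fun hj => ?_⟩⟩
  rcases (show mo.toSyn γ.exp ≤ mo.toSyn j from hj).lt_or_eq with hj | hj
  · exact (h.1 j).2 hj
  · rw [← mo.toSyn.injective hj]
    exact h.2

/-- A term of given exponent and coefficient occurring in `x` is at most any bound of `x`. -/
theorem le_of_mem_atMost {γ t : Term K n} {x : MvPowerSeries (Fin n) K} (hx : x ∈ atMost v mo γ)
    (ht : MvPowerSeries.coeff t.exp x = (t.1 : K)) : t.Le v mo γ := by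
  have h := hx t.exp
  rw [ht, ← Term.coe_val, WithTop.coe_le_coe, WithTop.coe_lt_coe] at h
  rcases h.1.lt_or_eq with h' | h'
  · exact Or.inl h'
  · refine Or.inr ⟨h'.symm, not_lt.mp fun h'' => ?_⟩
    have := h.2 h''
    omega

theorem lt_of_mem_below {γ t : Term K n} {x : MvPowerSeries (Fin n) K} (hx : x ∈ below v mo γ)
    (ht : MvPowerSeries.coeff t.exp x = (t.1 : K)) : t.Lt v mo γ := by
  have h := hx t.exp
  rw [ht, ← Term.coe_val, WithTop.coe_le_coe, WithTop.coe_lt_coe] at h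
  rcases h.1.lt_or_eq with h' | h'
  · exact Or.inl h'
  · refine Or.inr ⟨h'.symm, not_le.mp fun h'' => ?_⟩
    have := h.2 h''
    omega

theorem coeff_toSeries_mul (q : Term K n) (x : MvPowerSeries (Fin n) K) (j : Fin n →₀ ℕ) :
    MvPowerSeries.coeff j (q.toSeries * x) =
      if q.exp ≤ j then (q.1 : K) * MvPowerSeries.coeff (j - q.exp) x else 0 :=
  MvPowerSeries.coeff_monomial_mul _ _ _ _

theorem coeff_exp_add_toSeries_mul (q : Term K n) (x : MvPowerSeries (Fin n) K)
    (k : Fin n →₀ ℕ) :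
    MvPowerSeries.coeff (q.exp + k) (q.toSeries * x) = (q.1 : K) * MvPowerSeries.coeff k x :=
  MvPowerSeries.coeff_add_monomial_mul _ _ _ _

theorem toSeries_mul (s t : Term K n) : (s * t).toSeries = s.toSeries * t.toSeries :=
  (MvPowerSeries.monomial_mul_monomial _ _ _ _).symm

theorem toSeries_mul_mem_bounded {e : ℤ} {S T : Set (Fin n →₀ ℕ)} {x : MvPowerSeries (Fin n) K}
    (hx : x ∈ bounded v e S) (q : Term K n) (hT : ∀ k, q.exp + k ∈ T → k ∈ S) :
    q.toSeries * x ∈ bounded v (q.val v + e) T := by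
  intro j
  by_cases hj : q.exp ≤ j
  · obtain ⟨k, rfl⟩ := exists_add_of_le hj
    rw [coeff_exp_add_toSeries_mul, v.map_mul, ← Term.coe_val, WithTop.coe_add]
    exact ⟨by gcongr; exact (hx k).1,
      fun h => WithTop.add_lt_add_left (WithTop.coe_ne_top) ((hx k).2 (hT k h))⟩
  · rw [coeff_toSeries_mul, if_neg hj, v.map_zero]
    exact ⟨le_top, fun _ => WithTop.coe_lt_top _⟩

theorem toSeries_mul_mem_atMost {γ : Term K n} {x : MvPowerSeries (Fin n) K}
    (hx : x ∈ atMost v mo γ) (q : Term K n) : q.toSeries * x ∈ atMost v mo (q * γ) := by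
  rw [atMost, Term.val_mul]
  refine toSeries_mul_mem_bounded hx q fun k hk => ?_
  simpa [Term.exp_mul] using hk

theorem toSeries_mul_mem_negligible {p : ℤ} {x : MvPowerSeries (Fin n) K}
    (hx : x ∈ negligible v n p) (q : Term K n) :
    q.toSeries * x ∈ negligible v n (q.val v + p) :=
  toSeries_mul_mem_bounded hx q fun _ hk => hk

theorem Cong.toSeries_mul {p : ℤ} {x y : MvPowerSeries (Fin n) K} (h : Cong v p x y)
    (q : Term K n) : Cong v (p + q.val v) (q.toSeries * x) (q.toSeries * y) := by
  rw [cong_iff] at h ⊢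
  rw [← mul_sub, add_comm]
  exact toSeries_mul_mem_negligible h q

theorem mul_mem_negligible {p : ℤ} {x y : MvPowerSeries (Fin n) K}
    (hx : ∀ j, 0 ≤ v (MvPowerSeries.coeff j x)) (hy : y ∈ negligible v n p) :
    x * y ∈ negligible v n p := by
  classical
  rw [mem_negligible] at hy ⊢
  intro j
  rw [MvPowerSeries.coeff_mul]
  refine v.map_le_sum fun k _ => ?_
  rw [v.map_mul]
  exact (hy _).trans (le_add_of_nonneg_left (hx _))

theorem coeff_exp_toSeries (t : Term K n) :
    MvPowerSeries.coeff t.exp t.toSeries = (t.1 : K) := by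
  classical
  rw [Term.toSeries, MvPowerSeries.coeff_monomial, if_pos rfl]

theorem coeff_toSeries_of_ne {t : Term K n} {j : Fin n →₀ ℕ} (h : j ≠ t.exp) :
    MvPowerSeries.coeff j t.toSeries = 0 := by
  classical
  rw [Term.toSeries, MvPowerSeries.coeff_monomial, if_neg h]

theorem toSeries_mem_atMost (t : Term K n) : t.toSeries ∈ atMost v mo t := by
  intro j
  by_cases h : j = t.exp
  · subst h
    rw [coeff_exp_toSeries, ← Term.coe_val]
    exact ⟨le_rfl, fun h => absurd h (lt_irrefl _)⟩
  · rw [coeff_toSeries_of_ne h, v.map_zero]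
    exact ⟨le_top, fun _ => WithTop.coe_lt_top _⟩

theorem coeff_eq_of_toSeries_mul {q s : Term K n} {x : MvPowerSeries (Fin n) K}
    (h : MvPowerSeries.coeff s.exp x = (s.1 : K)) :
    MvPowerSeries.coeff (q * s).exp (q.toSeries * x) = ((q * s).1 : K) := by
  rw [Term.exp_mul, coeff_exp_add_toSeries_mul, h]
  rfl

/-! ### Leading terms -/

theorem exists_intTerm_of_coeff_ne_zero {r : IntTate v n} {i : Fin n →₀ ℕ}
    (h : MvPowerSeries.coeff i r.1 ≠ 0) :
    ∃ t : IntTerm v n, t.1.exp = i ∧ MvPowerSeries.coeff i r.1 = (t.1.1 : K) := by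
  refine ⟨⟨(Units.mk0 _ h, Multiplicative.ofAdd i), ?_⟩, rfl, rfl⟩
  have := r.2.2 i
  rw [← Units.val_mk0 h, ← coe_ord] at this
  exact WithTop.coe_le_coe.mp this

theorem isLeadingTerm_iff {f : IntTate v n} {t : IntTerm v n} :
    IsLeadingTerm v mo f t ↔
      MvPowerSeries.coeff t.1.exp f.1 = (t.1.1 : K) ∧ f.1 ∈ atMost v mo t.1 := by
  refine and_congr_right fun _ => ⟨fun h j => ?_, fun h s hs => le_of_mem_atMost h hs⟩
  by_cases hj : MvPowerSeries.coeff j f.1 = 0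
  · rw [hj, v.map_zero]
    exact ⟨le_top, fun _ => WithTop.coe_lt_top _⟩
  · have h' := h (Units.mk0 _ hj, Multiplicative.ofAdd j) rfl
    have hv := Term.coe_val v (Units.mk0 _ hj, Multiplicative.ofAdd j)
    simp only [Units.val_mk0] at hv
    rw [← hv, WithTop.coe_le_coe, WithTop.coe_lt_coe]
    rcases h' with h' | ⟨h₁, h₂⟩
    · exact ⟨h'.le, fun _ => h'⟩
    · exact ⟨h₁.ge, fun h₃ => absurd h₂ (not_le.mpr h₃)⟩

theorem IsLeadingTerm.unique {f : IntTate v n} {s t : IntTerm v n} (hs : IsLeadingTerm v mo f s)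
    (ht : IsLeadingTerm v mo f t) : s = t := by
  have h₁ := hs.2 t.1 ht.1
  have h₂ := ht.2 s.1 hs.1
  rcases h₁.lt_or_eq with h | h
  · exact ((h.trans_le h₂).irrefl).elim
  · refine Subtype.ext (Term.ext_of_coeff ?_ h.2.symm)
    rw [← hs.1, ← ht.1, h.2]

/-- Every nonzero series has a leading term: finitely many of its terms have minimal valuation. -/
theorem exists_isLeadingTerm {f : IntTate v n} (hf : f ≠ 0) : ∃ t, IsLeadingTerm v mo f t := by
  have hex : ∃ j, MvPowerSeries.coeff j f.1 ≠ 0 := by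
    by_contra h
    push Not at h
    exact hf (Subtype.ext (MvPowerSeries.ext fun j => by simpa using h j))
  obtain ⟨j₀, hj₀⟩ := hex
  -- the set of exponents whose coefficient has a valuation at most that of `X ^ j₀`
  have hfin := f.2.1 (ord v (Units.mk0 _ hj₀) + 1)
  have hv₀ : (ord v (Units.mk0 _ hj₀) : WithTop ℤ) = v (MvPowerSeries.coeff j₀ f.1) :=
    coe_ord v (Units.mk0 _ hj₀)
  have hmem₀ : j₀ ∈ {i | v (MvPowerSeries.coeff i f.1) <
      ((ord v (Units.mk0 _ hj₀) + 1 : ℤ) : WithTop ℤ)} := by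
    rw [Set.mem_ofPred_eq, ← hv₀, WithTop.coe_lt_coe]
    omega
  obtain ⟨j₁, hj₁, hmin⟩ := Set.exists_min_image _
    (fun i => v (MvPowerSeries.coeff i f.1)) hfin ⟨j₀, hmem₀⟩
  obtain ⟨j₂, hj₂, hmax⟩ := Set.exists_max_image
    {i | v (MvPowerSeries.coeff i f.1) = v (MvPowerSeries.coeff j₁ f.1)} (fun i => mo.toSyn i)
    (hfin.subset fun i hi => by
      rw [Set.mem_ofPred_eq] at hi hj₁ ⊢
      rwa [hi]) ⟨j₁, rfl⟩
  have hle : ∀ i, v (MvPowerSeries.coeff j₁ f.1) ≤ v (MvPowerSeries.coeff i f.1) := by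
    intro i
    by_cases hi : v (MvPowerSeries.coeff i f.1) < ((ord v (Units.mk0 _ hj₀) + 1 : ℤ) : WithTop ℤ)
    · exact hmin i hi
    · exact (le_of_lt hj₁).trans (not_lt.mp hi)
  have hne : MvPowerSeries.coeff j₂ f.1 ≠ 0 := by
    rw [← v.ne_top_iff, show v _ = v _ from hj₂]
    exact ne_top_of_lt hj₁
  have hv₂ : (ord v (Units.mk0 _ hne) : WithTop ℤ) = v (MvPowerSeries.coeff j₂ f.1) :=
    coe_ord v (Units.mk0 _ hne)
  refine ⟨⟨(Units.mk0 _ hne, Multiplicative.ofAdd j₂), ?_⟩,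
    isLeadingTerm_iff.mpr ⟨rfl, fun i => ?_⟩⟩
  · have := f.2.2 j₂
    rw [← hv₂] at this
    exact WithTop.coe_le_coe.mp this
  · change ((ord v (Units.mk0 _ hne) : ℤ) : WithTop ℤ) ≤ _ ∧ (mo.toSyn j₂ < mo.toSyn i →
      ((ord v (Units.mk0 _ hne) : ℤ) : WithTop ℤ) < _)
    rw [hv₂, show v (MvPowerSeries.coeff j₂ f.1) = _ from hj₂]
    refine ⟨hle i, fun hi => (hle i).lt_of_ne fun h => ?_⟩
    exact not_lt.mpr (hmax i h.symm) hi

theorem IsLeadingTerm.val_lt {f : IntTate v n} {t : IntTerm v n} (ht : IsLeadingTerm v mo f t)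
    {p : ℤ} (hf : f.1 ∉ negligible v n p) : t.1.val v < p := by
  by_contra h
  refine hf (negligible_mono (not_lt.mp h) (mem_negligible.mpr fun j => ?_))
  exact ((isLeadingTerm_iff.mp ht).2 j).1

theorem Approx.IsLT.val_lt {F : Approx v n} {t : IntTerm v n} (ht : F.IsLT mo t) :
    t.1.val v < F.prec :=
  ht.2.val_lt fun h => ht.1 (Approx.vanishes_iff.mpr h)

theorem Approx.exists_isLT {F : Approx v n} (hF : ¬ F.Vanishes) : ∃ t, F.IsLT mo t := by
  have h0 : F.center ≠ 0 := fun h => hF (by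
    rw [Approx.vanishes_iff, h]
    exact zero_mem _)
  obtain ⟨t, ht⟩ := exists_isLeadingTerm (mo := mo) h0
  exact ⟨t, hF, ht⟩

theorem Approx.IsLT.mem_atMost {F : Approx v n} {t : IntTerm v n} (ht : F.IsLT mo t) :
    F.center.1 ∈ atMost v mo t.1 :=
  (isLeadingTerm_iff.mp ht.2).2

theorem Approx.IsLT.coeff_eq {F : Approx v n} {t : IntTerm v n} (ht : F.IsLT mo t) :
    MvPowerSeries.coeff t.1.exp F.center.1 = (t.1.1 : K) :=
  ht.2.1

/-- The valuation and the exponent of the leading term depend only on the class of the series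
modulo a precision at which it does not vanish. -/
theorem IsLeadingTerm.exists_of_sub_mem {f g : IntTate v n} {t : IntTerm v n} {p : ℤ}
    (ht : IsLeadingTerm v mo f t) (hp : t.1.val v < p) (h : f.1 - g.1 ∈ negligible v n p) :
    ∃ t', IsLeadingTerm v mo g t' ∧ t'.1.val v = t.1.val v ∧ t'.1.exp = t.1.exp := by
  have hv : v (MvPowerSeries.coeff t.1.exp g.1) = t.1.val v := by
    rw [Term.coe_val, ← ht.1]
    refine v.map_eq_of_lt_sub ?_
    rw [← v.map_sub_swap, ← map_sub, ht.1, ← Term.coe_val]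
    exact (WithTop.coe_lt_coe.mpr hp).trans_le (mem_negligible.mp h t.1.exp)
  have hne : MvPowerSeries.coeff t.1.exp g.1 ≠ 0 := by
    rw [← v.ne_top_iff, hv]
    exact WithTop.coe_ne_top
  have hval : ord v (Units.mk0 _ hne) = t.1.val v := by
    have := coe_ord v (Units.mk0 _ hne)
    rw [Units.val_mk0, hv] at this
    exact WithTop.coe_injective this
  let t' : Term K n := (Units.mk0 _ hne, Multiplicative.ofAdd t.1.exp)
  have hmem : g.1 ∈ atMost v mo t' := by
    refine atMost_mono (Term.le_of_val_eq_of_exp_eq (t := t') hval.symm rfl) ?_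
    rw [← sub_sub_cancel f.1 g.1]
    exact sub_mem (isLeadingTerm_iff.mp ht).2 (below_le_atMost _ (negligible_le_below hp h))
  exact ⟨⟨t', t.2.trans_eq hval.symm⟩, isLeadingTerm_iff.mpr ⟨rfl, hmem⟩, hval, rfl⟩

/-- A term, as an element of the integral Tate algebra. -/
noncomputable def IntTerm.toTate (t : IntTerm v n) : IntTate v n :=
  ⟨t.1.toSeries, by
    classical
    refine ⟨fun M => (Set.finite_singleton t.1.exp).subset fun i hi => ?_, fun i => ?_⟩
    · by_contra h
      rw [Set.mem_ofPred_eq, coeff_toSeries_of_ne h, v.map_zero] at hi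
      exact not_top_lt hi
    · by_cases h : i = t.1.exp
      · rw [h, coeff_exp_toSeries, ← Term.coe_val]
        exact WithTop.coe_le_coe.mpr t.2
      · rw [coeff_toSeries_of_ne h, v.map_zero]
        exact le_top⟩

theorem IsLeadingTerm.mul {f : IntTate v n} {t : IntTerm v n} (ht : IsLeadingTerm v mo f t)
    (q : IntTerm v n) : IsLeadingTerm v mo (IntTerm.toTate q * f) (q * t) :=
  isLeadingTerm_iff.mpr ⟨coeff_eq_of_toSeries_mul ht.1,
    toSeries_mul_mem_atMost (isLeadingTerm_iff.mp ht).2 q.1⟩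

theorem isMonoidIdeal_leadingTerms (I : Ideal (IntTate v n)) :
    IsMonoidIdeal (leadingTerms v mo I) := by
  rintro a t ⟨f, hf, ht⟩
  exact ⟨_, I.mul_mem_left _ hf, ht.mul a⟩

end Bounds

/-! ### Combinations with bounded leading terms and Buchberger's criterion -/

section Buchberger

variable {K : Type*} [Field K] {v : AddValuation K (WithTop ℤ)} {n : ℕ} (mo : MonomialOrder (Fin n))
  (N : ℤ)

/-- The series congruent modulo `O(π ^ N)` to a finite sum of multiples `q g`, with `q` an integral
term and `g` a nonvanishing member of `G` such that `q LT(g)` satisfies `P`. -/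
def combos (G : List (Approx v n)) (P : Term K n → Prop) :
    AddSubgroup (MvPowerSeries (Fin n) K) :=
  AddSubgroup.closure
    ({x | ∃ g ∈ G, ∃ s, g.IsLT mo s ∧ ∃ q : IntTerm v n, P (q * s).1 ∧
      x = q.1.toSeries * g.center.1} ∪ negligible v n N)

/-- The pair `(f, g)` satisfies Buchberger's condition with respect to `G`: whenever two multiples
`u f` and `w g` have the same leading term, of valuation less than `N`, their difference is a
combination of multiples of members of `G` of smaller leading term. -/
def Good (G : List (Approx v n)) (f g : Approx v n) : Prop :=
  ∀ s t : IntTerm v n, f.IsLT mo s → g.IsLT mo t → ∀ u w : IntTerm v n, u * s = w * t →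
    (u * s).1.val v < N →
    u.1.toSeries * f.center.1 - w.1.toSeries * g.center.1 ∈
      combos mo N G fun γ => γ.Lt v mo (u * s).1

variable {mo N}

theorem mem_combos {G : List (Approx v n)} {P : Term K n → Prop} {g : Approx v n} (hg : g ∈ G)
    {s q : IntTerm v n} (hs : g.IsLT mo s) (hP : P (q * s).1) :
    q.1.toSeries * g.center.1 ∈ combos mo N G P :=
  AddSubgroup.subset_closure (Or.inl ⟨g, hg, s, hs, q, hP, rfl⟩)

theorem negligible_le_combos (G : List (Approx v n)) (P : Term K n → Prop) :
    negligible v n N ≤ combos mo N G P := fun _ hx =>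
  AddSubgroup.subset_closure (Or.inr hx)

theorem combos_le {G : List (Approx v n)} {P : Term K n → Prop}
    {A : AddSubgroup (MvPowerSeries (Fin n) K)} (hA : negligible v n N ≤ A)
    (h : ∀ g ∈ G, ∀ s, g.IsLT mo s → ∀ q : IntTerm v n, P (q * s).1 →
      q.1.toSeries * g.center.1 ∈ A) : combos mo N G P ≤ A := by
  refine (AddSubgroup.closure_le _).mpr (Set.union_subset ?_ hA)
  rintro _ ⟨g, hg, s, hs, q, hP, rfl⟩
  exact h g hg s hs q hP

theorem combos_mono {G G' : List (Approx v n)} {P P' : Term K n → Prop} (hG : G ⊆ G')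
    (hP : ∀ γ, P γ → P' γ) : combos mo N G P ≤ combos mo N G' P' :=
  combos_le (negligible_le_combos _ _) fun _ hg _ hs _ h => mem_combos (hG hg) hs (hP _ h)

theorem combos_lt_le_below (G : List (Approx v n)) {γ : Term K n} (hγ : γ.val v < N) :
    (combos mo N G fun δ => δ.Lt v mo γ) ≤ below v mo γ :=
  combos_le (negligible_le_below hγ) fun _ _ _ hs q hP =>
    atMost_le_below hP (toSeries_mul_mem_atMost hs.mem_atMost q.1)

theorem combos_le_le_atMost (G : List (Approx v n)) {γ : Term K n} (hγ : γ.val v < N) :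
    (combos mo N G fun δ => δ.Le v mo γ) ≤ atMost v mo γ :=
  combos_le ((negligible_le_below hγ).trans (below_le_atMost γ)) fun _ _ _ hs q hP =>
    atMost_mono hP (toSeries_mul_mem_atMost hs.mem_atMost q.1)

theorem combos_le_le_negligible (G : List (Approx v n)) {γ : Term K n} (hγ : N ≤ γ.val v) :
    (combos mo N G fun δ => δ.Le v mo γ) ≤ negligible v n N :=
  combos_le le_rfl fun _ _ _ hs q hP => negligible_mono hγ
    (mem_negligible.mpr fun j =>
      (atMost_mono hP (toSeries_mul_mem_atMost hs.mem_atMost q.1) j).1)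

theorem toSeries_mul_mem_combos {G : List (Approx v n)} {γ : Term K n}
    {x : MvPowerSeries (Fin n) K} (hx : x ∈ combos mo N G fun δ => δ.Lt v mo γ)
    (c : IntTerm v n) :
    c.1.toSeries * x ∈ combos mo N G fun δ => δ.Lt v mo (c.1 * γ) := by
  have h : (combos mo N G fun δ => δ.Lt v mo γ) ≤
      (combos mo N G fun δ => δ.Lt v mo (c.1 * γ)).comap
        (AddMonoidHom.mulLeft c.1.toSeries) := by
    refine combos_le (fun y hy => ?_) fun g hg s hs q hP => ?_
    · rw [AddSubgroup.mem_comap, AddMonoidHom.coe_mulLeft]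
      refine negligible_le_combos _ _ (negligible_mono ?_ (toSeries_mul_mem_negligible hy c.1))
      have := IntTerm.val_nonneg v c
      omega
    · rw [AddSubgroup.mem_comap, AddMonoidHom.coe_mulLeft, ← mul_assoc, ← toSeries_mul]
      refine mem_combos (q := c * q) hg hs ?_
      rw [mul_assoc]
      exact hP.mul_left c.1
  exact h hx

/-- A combination involves finitely many multiples only, so that their leading terms have an upper
bound among them. -/
theorem exists_bound_of_mem_combos {G : List (Approx v n)} {P : Term K n → Prop}
    {x : MvPowerSeries (Fin n) K} (hx : x ∈ combos mo N G P) :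
    x ∈ negligible v n N ∨
      ∃ γ : IntTerm v n, P γ.1 ∧ x ∈ combos mo N G fun δ => δ.Le v mo γ.1 := by
  induction hx using AddSubgroup.closure_induction with
  | mem x hx =>
    rcases hx with ⟨g, hg, s, hs, q, hP, rfl⟩ | hx
    · exact Or.inr ⟨q * s, hP, mem_combos hg hs (Or.inr ⟨rfl, le_rfl⟩)⟩
    · exact Or.inl hx
  | zero => exact Or.inl (zero_mem _)
  | neg x _ ih =>
    rcases ih with h | ⟨γ, hγ, h⟩
    · exact Or.inl (neg_mem h)
    · exact Or.inr ⟨γ, hγ, neg_mem h⟩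
  | add x y _ _ ihx ihy =>
    rcases ihx with hx | ⟨γ, hγ, hx⟩ <;> rcases ihy with hy | ⟨γ', hγ', hy⟩
    · exact Or.inl (add_mem hx hy)
    · exact Or.inr ⟨γ', hγ', add_mem (negligible_le_combos _ _ hx) hy⟩
    · exact Or.inr ⟨γ, hγ, add_mem hx (negligible_le_combos _ _ hy)⟩
    · have key : ∀ {α β : Term K n}, α.Le v mo β → (combos mo N G fun δ => δ.Le v mo α) ≤
          combos mo N G fun δ => δ.Le v mo β := fun h => combos_mono (List.Subset.refl _)
        fun δ hδ => (hδ.lt_or_eq).elim (fun h' => (h'.trans_le h).le) fun h' => by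
          rcases h with h | h
          · exact Or.inl (by omega)
          · exact Or.inr ⟨by omega, by rw [h'.2]; exact h.2⟩
      rcases Term.le_total (v := v) (mo := mo) γ.1 γ'.1 with h | h
      · exact Or.inr ⟨γ', hγ', add_mem (key h hx) hy⟩
      · exact Or.inr ⟨γ, hγ, add_mem hx (key h hy)⟩

theorem Good.symm {G : List (Approx v n)} {f g : Approx v n} (h : Good mo N G f g) :
    Good mo N G g f := by
  intro s t hs ht u w huw hval
  rw [← neg_sub]
  rw [huw] at hval ⊢
  exact neg_mem (h t s ht hs w u huw.symm hval)

theorem good_self (G : List (Approx v n)) (f : Approx v n) : Good mo N G f f := by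
  intro s t hs ht u w huw _
  obtain rfl := hs.2.unique ht.2
  obtain rfl : u = w := Subtype.ext (mul_right_cancel (congrArg Subtype.val huw))
  rw [sub_self]
  exact zero_mem _

theorem Good.mono {G G' : List (Approx v n)} {f g : Approx v n} (h : Good mo N G f g)
    (hG : G ⊆ G') : Good mo N G' f g := fun s t hs ht u w huw hval =>
  combos_mono hG (fun _ => id) (h s t hs ht u w huw hval)

theorem smul_toSeries (c : K) (hc : c ≠ 0) (q : Term K n) :
    Term.toSeries (Units.mk0 c hc * q.1, q.2) = c • q.toSeries := by
  classical
  ext j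
  rw [MvPowerSeries.coeff_smul]
  by_cases h : j = q.exp
  · subst h
    rw [coeff_exp_toSeries]
    exact coeff_exp_toSeries (Units.mk0 c hc * q.1, q.2)
  · rw [coeff_toSeries_of_ne h, mul_zero]
    exact coeff_toSeries_of_ne (t := (Units.mk0 c hc * q.1, q.2)) h

/-- All multiples of leading term `γ` are proportional, up to combinations of smaller leading
terms, to one of them. -/
theorem exists_sub_smul_mem {G : List (Approx v n)} (hG : ∀ f ∈ G, ∀ g ∈ G, Good mo N G f g)
    {g₁ : Approx v n} (hg₁ : g₁ ∈ G) {s₁ q₁ : IntTerm v n} (hs₁ : g₁.IsLT mo s₁)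
    (hval : (q₁ * s₁).1.val v < N) {x : MvPowerSeries (Fin n) K}
    (hx : x ∈ combos mo N G fun δ => δ.Le v mo (q₁ * s₁).1) :
    ∃ c : K, 0 ≤ v c ∧ x - c • (q₁.1.toSeries * g₁.center.1) ∈
      combos mo N G fun δ => δ.Lt v mo (q₁ * s₁).1 := by
  induction hx using AddSubgroup.closure_induction with
  | mem x hx =>
    rcases hx with ⟨g, hg, s, hs, q, hP, rfl⟩ | hx
    · rcases hP.lt_or_eq with hP | ⟨h₁, h₂⟩
      · refine ⟨0, by simp, ?_⟩
        rw [zero_smul, sub_zero]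
        exact mem_combos hg hs hP
      · -- the two multiples have the same leading term up to a unit `c`
        have hc0 : 0 = ord v ((q * s).1.1 / (q₁ * s₁).1.1) := by
          have := ord_mul v ((q * s).1.1 / (q₁ * s₁).1.1) (q₁ * s₁).1.1
          rw [div_mul_cancel] at this
          change ord v (q * s).1.1 = ord v (q₁ * s₁).1.1 at h₁
          omega
        have hc := coe_ord v ((q * s).1.1 / (q₁ * s₁).1.1)
        rw [← hc0] at hc
        refine ⟨_, hc.le, ?_⟩
        let c : IntTerm v n := ⟨((q * s).1.1 / (q₁ * s₁).1.1, 1), hc0.le⟩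
        have hcs : (c * q₁).1.toSeries = (c.1.1 : K) • q₁.1.toSeries := by
          rw [← smul_toSeries _ (Units.ne_zero _), Units.mk0_val]
          exact congrArg Term.toSeries (Prod.ext rfl (one_mul q₁.1.2))
        have heq : q * s = (c * q₁) * s₁ := by
          rw [mul_assoc]
          refine Subtype.ext (Prod.ext (div_mul_cancel (q * s).1.1 (q₁ * s₁).1.1).symm ?_)
          exact (show (q * s).1.2 = (q₁ * s₁).1.2 from h₂).trans (one_mul (q₁ * s₁).1.2).symm
        have := hG g hg g₁ hg₁ s s₁ hs hs₁ q (c * q₁) heq (h₁.trans_lt hval)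
        rw [hcs, smul_mul_assoc] at this
        refine combos_mono (List.Subset.refl _) (fun δ hδ => ?_) this
        exact hδ.trans_le (Term.le_of_val_eq_of_exp_eq h₁ h₂)
    · refine ⟨0, by simp, ?_⟩
      rw [zero_smul, sub_zero]
      exact negligible_le_combos _ _ hx
  | zero =>
    refine ⟨0, by simp, ?_⟩
    rw [zero_smul, sub_zero]
    exact zero_mem _
  | neg x _ ih =>
    obtain ⟨c, hc, h⟩ := ih
    refine ⟨-c, by rwa [v.map_neg], ?_⟩
    convert neg_mem h using 1
    rw [neg_smul]
    abel
  | add x y _ _ ihx ihy =>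
    obtain ⟨c, hc, h⟩ := ihx
    obtain ⟨c', hc', h'⟩ := ihy
    refine ⟨c + c', v.map_le_add hc hc', ?_⟩
    convert add_mem h h' using 1
    rw [add_smul]
    abel

/-- The cancellation step of Buchberger's criterion: if the greatest leading term of a combination
cancels, the combination can be rewritten with smaller leading terms. -/
theorem mem_combos_lt_of_mem_below {G : List (Approx v n)}
    (hG : ∀ f ∈ G, ∀ g ∈ G, Good mo N G f g) {γ : IntTerm v n} (hγ : γ.1.val v < N)
    {x : MvPowerSeries (Fin n) K} (hx : x ∈ combos mo N G fun δ => δ.Le v mo γ.1)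
    (hx' : x ∈ below v mo γ.1 ∨ ∀ g ∈ G, ∀ s, g.IsLT mo s → ¬ s ∣ γ) :
    x ∈ combos mo N G fun δ => δ.Lt v mo γ.1 := by
  by_cases hdiv : ∃ g ∈ G, ∃ s, g.IsLT mo s ∧ s ∣ γ
  · replace hx' : x ∈ below v mo γ.1 := hx'.resolve_right fun h => by
      obtain ⟨g, hg, s, hs, hd⟩ := hdiv
      exact h g hg s hs hd
    obtain ⟨g, hg, s, hs, q, rfl⟩ := hdiv
    rw [mul_comm] at hγ hx hx' ⊢
    obtain ⟨c, hc, h⟩ := exists_sub_smul_mem hG hg hs hγ hx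
    rcases eq_or_ne c 0 with rfl | hc0
    · simpa using h
    -- the coefficient of `x` at the exponent of `γ` shows that `c` is not a unit
    have hcv : 0 < v c := by
      have h₁ := (mem_below_iff.mp (sub_mem hx' (combos_lt_le_below G hγ h))).2
      rw [sub_sub_cancel, MvPowerSeries.coeff_smul, Submonoid.coe_mul,
        coeff_eq_of_toSeries_mul hs.coeff_eq, v.map_mul, ← Term.coe_val] at h₁
      by_contra h₂
      rw [le_antisymm (not_lt.mp h₂) hc, zero_add] at h₁
      exact lt_irrefl _ h₁
    have hco := coe_ord v (Units.mk0 c hc0)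
    rw [Units.val_mk0] at hco
    have hcpos : 0 < ord v (Units.mk0 c hc0) := by
      rw [← hco] at hcv
      exact WithTop.coe_lt_coe.mp hcv
    let c' : IntTerm v n := ⟨(Units.mk0 c hc0, 1), hcpos.le⟩
    have hcs : (c' * q).1.toSeries = c • q.1.toSeries := by
      rw [← smul_toSeries _ hc0]
      exact congrArg Term.toSeries (Prod.ext rfl (one_mul q.1.2))
    rw [← sub_add_cancel x (c • (q.1.toSeries * g.center.1))]
    refine add_mem h ?_
    rw [← smul_mul_assoc, ← hcs]
    refine mem_combos hg hs (Or.inl ?_)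
    rw [mul_assoc]
    change _ < (c'.1 * (q * s).1).val v
    rw [Term.val_mul]
    exact lt_add_of_pos_left _ hcpos
  · push Not at hdiv
    refine combos_le (negligible_le_combos _ _) (fun g hg s hs q hP => ?_) hx
    rcases hP.lt_or_eq with hP | ⟨h₁, h₂⟩
    · exact mem_combos hg hs hP
    · refine absurd (IntTerm.dvd_iff.mpr ?_) (hdiv g hg s hs)
      rw [← h₁, ← h₂]
      exact IntTerm.dvd_iff.mp (dvd_mul_left s q)

/-- **Buchberger's criterion** at finite precision: if all pairs of members of `G` satisfy
Buchberger's condition, the leading term of every combination of `G` that does not vanish modulo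
`O(π ^ N)` is divisible by the leading term of a member of `G`. -/
theorem exists_isLT_dvd {G : List (Approx v n)} (hG : ∀ f ∈ G, ∀ g ∈ G, Good mo N G f g)
    {x : IntTate v n} (hx : x.1 ∈ combos mo N G fun _ => True) {t : IntTerm v n}
    (ht : IsLeadingTerm v mo x t) (hval : t.1.val v < N) :
    ∃ g ∈ G, ∃ s, g.IsLT mo s ∧ s ∣ t := by
  have hneg : x.1 ∉ negligible v n N := fun h => by
    have := mem_negligible.mp h t.1.exp
    rw [ht.1, ← Term.coe_val, WithTop.coe_le_coe] at this
    omega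
  obtain ⟨γ, -, hγx⟩ := (exists_bound_of_mem_combos hx).resolve_left hneg
  have hγ : ∀ γ : Term K n, (x.1 ∈ combos mo N G fun δ => δ.Le v mo γ) → γ.val v < N :=
    fun γ h => not_le.mp fun h' => hneg (combos_le_le_negligible G h' h)
  induction hδ : γ.1 using (Term.wellFounded_lt_of_val_lt v mo N).induction generalizing γ with
  | _ δ ih =>
  subst hδ
  have hle := le_of_mem_atMost (combos_le_le_atMost G (hγ _ hγx) hγx) ht.1
  by_contra hcon
  have hmem : x.1 ∈ combos mo N G fun δ => δ.Lt v mo γ.1 := by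
    refine mem_combos_lt_of_mem_below hG (hγ _ hγx) hγx ?_
    rcases hle.lt_or_eq with hlt | ⟨h₁, h₂⟩
    · exact Or.inl (atMost_le_below hlt (isLeadingTerm_iff.mp ht).2)
    · refine Or.inr fun g hg s hs hd => hcon ⟨g, hg, s, hs, IntTerm.dvd_iff.mpr ?_⟩
      rw [h₁, h₂]
      exact IntTerm.dvd_iff.mp hd
  obtain ⟨γ', hlt, h'⟩ := (exists_bound_of_mem_combos hmem).resolve_left hneg
  exact hcon (ih γ'.1 ⟨hlt, hγ _ h', hγ _ hγx⟩ γ' h' rfl)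

/-- An integral series is a polynomial modulo `O(π ^ N)`, so that its product with a nonvanishing
member of `G` is a combination. -/
theorem mul_mem_combos {G : List (Approx v n)} {g : Approx v n} (hg : g ∈ G) {s : IntTerm v n}
    (hs : g.IsLT mo s) (u : IntTate v n) :
    u.1 * g.center.1 ∈ combos mo N G fun _ => True := by
  classical
  set p : MvPowerSeries (Fin n) K :=
    ∑ i ∈ (u.2.1 N).toFinset, MvPowerSeries.monomial i (MvPowerSeries.coeff i u.1) with hp
  have hcoeff : ∀ j, MvPowerSeries.coeff j p =
      if v (MvPowerSeries.coeff j u.1) < N then MvPowerSeries.coeff j u.1 else 0 := by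
    intro j
    simp [hp, MvPowerSeries.coeff_monomial]
  have hup : u.1 - p ∈ negligible v n N := by
    refine mem_negligible.mpr fun j => ?_
    rw [map_sub, hcoeff]
    split_ifs with h
    · simp
    · simpa using h
  rw [← sub_add_cancel u.1 p, add_mul]
  refine add_mem (negligible_le_combos _ _ ?_) ?_
  · rw [mul_comm]
    exact mul_mem_negligible g.center.2.2 hup
  · rw [hp, Finset.sum_mul]
    refine sum_mem fun i hi => ?_
    have hi' : v (MvPowerSeries.coeff i u.1) < N := by simpa using hi
    obtain ⟨q, rfl, hq⟩ := exists_intTerm_of_coeff_ne_zero (v.ne_top_iff.mp (ne_top_of_lt hi'))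
    rw [hq]
    exact mem_combos (q := q) hg hs trivial

/-- If the generators of `I` are known at precision `O(π ^ N)` by members of `G`, all elements of
`I` are combinations of `G`. -/
theorem mem_combos_of_mem_span {m : ℕ} {f : Fin m → IntTate v n} {F : Fin m → Approx v n}
    (hF : ∀ i, (F i).Represents (f i).1 N) {G : List (Approx v n)} (hFG : ∀ i, F i ∈ G)
    {x : IntTate v n} (hx : x ∈ Ideal.span (Set.range f)) :
    x.1 ∈ combos mo N G fun _ => True := by
  obtain ⟨c, rfl⟩ := (Ideal.mem_span_range_iff_exists_fun).mp hx
  rw [← Subring.subtype_apply, map_sum]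
  refine sum_mem fun i _ => ?_
  have hi : (F i).center.1 - (f i).1 ∈ negligible v n N := cong_iff.mp (hF i).2
  change (c i).1 * (f i).1 ∈ _
  rw [← sub_sub_cancel (F i).center.1 (f i).1, mul_sub]
  refine sub_mem ?_ (negligible_le_combos _ _ (mul_mem_negligible (c i).2.2 hi))
  by_cases hvan : (F i).Vanishes
  · refine negligible_le_combos _ _ (mul_mem_negligible (c i).2.2 ?_)
    rw [← (hF i).1]
    exact Approx.vanishes_iff.mp hvan
  · obtain ⟨s, hs⟩ := Approx.exists_isLT (mo := mo) hvan
    exact mul_mem_combos (hFG i) hs (c i)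

end Buchberger

/-! ### One division step -/

section Division

variable {K : Type*} [Field K] {v : AddValuation K (WithTop ℤ)} {n : ℕ} {mo : MonomialOrder (Fin n)}

theorem isLeadingTerm_toTate (t : IntTerm v n) : IsLeadingTerm v mo (IntTerm.toTate t) t :=
  isLeadingTerm_iff.mpr ⟨coeff_exp_toSeries _, toSeries_mem_atMost _⟩

theorem val_eq_and_exp_eq_of_cong {s t : IntTerm v n} {p : ℤ}
    (h : Cong v p s.1.toSeries t.1.toSeries) (hs : s.1.val v < p) :
    t.1.val v = s.1.val v ∧ t.1.exp = s.1.exp := by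
  obtain ⟨t', ht', h'⟩ := (isLeadingTerm_toTate (mo := MonomialOrder.lex) s).exists_of_sub_mem
    (g := IntTerm.toTate t) hs (cong_iff.mp h)
  rwa [ht'.unique (isLeadingTerm_toTate t)] at h'

/-- An equality of terms `LT(h) = q LT(g)` at the working precision is an equality of valuations
and exponents, and these are significant at this precision. -/
theorem val_exp_of_reduce {h g : Approx v n} {s t q : IntTerm v n} (ht : h.IsLT mo t)
    (hs : g.IsLT mo s)
    (hq : Cong v (min h.prec (g.prec + q.1.val v)) t.1.toSeries (q * s).1.toSeries) :
    (q * s).1.val v = t.1.val v ∧ (q * s).1.exp = t.1.exp ∧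
      t.1.val v < min h.prec (g.prec + q.1.val v) := by
  have h₁ := ht.val_lt
  have h₂ := hs.val_lt
  have h₃ : (q * s).1.val v = q.1.val v + s.1.val v := Term.val_mul v q.1 s.1
  by_cases hlt : t.1.val v < min h.prec (g.prec + q.1.val v)
  · exact ⟨(val_eq_and_exp_eq_of_cong hq hlt).1, (val_eq_and_exp_eq_of_cong hq hlt).2, hlt⟩
  · have := (val_eq_and_exp_eq_of_cong hq.symm (by omega)).1
    omega

/-- Subtracting a multiple of equal leading term lowers the leading term. -/
theorem mem_below_of_reduce {h h' g : Approx v n} {s t q : IntTerm v n} (ht : h.IsLT mo t)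
    (hs : g.IsLT mo s)
    (hq : Cong v (min h.prec (g.prec + q.1.val v)) t.1.toSeries (q * s).1.toSeries)
    (hh' : h'.Represents (h.center.1 - q.1.toSeries * g.center.1)
      (min h.prec (g.prec + q.1.val v))) :
    h'.center.1 ∈ below v mo t.1 := by
  obtain ⟨h₁, h₂, h₃⟩ := val_exp_of_reduce ht hs hq
  rw [← sub_add_cancel h'.center.1 (h.center.1 - q.1.toSeries * g.center.1)]
  refine add_mem (negligible_le_below h₃ (cong_iff.mp hh'.2)) (mem_below_iff.mpr ⟨?_, ?_⟩)
  · exact sub_mem ht.mem_atMost (atMost_mono (Term.le_of_val_eq_of_exp_eq h₁ h₂)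
      (toSeries_mul_mem_atMost hs.mem_atMost q.1))
  · have hc := hq t.1.exp
    have hqs := coeff_eq_of_toSeries_mul (q := q.1) hs.coeff_eq
    rw [map_sub, coeff_exp_toSeries, ← h₂, coeff_exp_toSeries] at hc
    rw [← Submonoid.coe_mul, h₂] at hqs
    rw [map_sub (MvPowerSeries.coeff (R := K) t.1.exp), ht.coeff_eq, hqs]
    exact (WithTop.coe_lt_coe.mpr h₃).trans_le hc

/-- Removing the leading term lowers the leading term. -/
theorem mem_below_of_move {h h' : Approx v n} {t : IntTerm v n} (ht : h.IsLT mo t)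
    (hh' : h'.Represents (h.center.1 - t.1.toSeries) h.prec) :
    h'.center.1 ∈ below v mo t.1 := by
  rw [← sub_add_cancel h'.center.1 (h.center.1 - t.1.toSeries)]
  refine add_mem (negligible_le_below ht.val_lt (cong_iff.mp hh'.2)) (mem_below_iff.mpr ⟨?_, ?_⟩)
  · exact sub_mem ht.mem_atMost (toSeries_mem_atMost _)
  · rw [map_sub, ht.coeff_eq, coeff_exp_toSeries, sub_self, v.map_zero]
    exact WithTop.coe_lt_top _

end Division

/-! ### S-polynomials -/

section SPoly

variable {K : Type*} [Field K] {v : AddValuation K (WithTop ℤ)} {n : ℕ} {mo : MonomialOrder (Fin n)}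
  {π : Kˣ}

theorem ord_zpow (hπ : v (π : K) = 1) (k : ℤ) : ord v (π ^ k) = k := by
  have h1 : ord v π = 1 := by
    have := coe_ord v π
    rw [hπ] at this
    exact_mod_cast this
  let φ : Kˣ →* Multiplicative ℤ :=
    { toFun a := Multiplicative.ofAdd (ord v a)
      map_one' := congrArg Multiplicative.ofAdd (ord_one v)
      map_mul' a b := congrArg Multiplicative.ofAdd (ord_mul v a b) }
  have h := map_zpow φ π k
  replace h := congrArg Multiplicative.toAdd h
  change ord v (π ^ k) = k • ord v π at h
  rw [h, h1, smul_eq_mul, mul_one]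

variable {s t : IntTerm v n} {a b : Term K n}

theorem val_of_mul_gcd (hπ : v (π : K) = 1) (ha : a * Term.gcd v π s.1 t.1 = t.1)
    (hb : b * Term.gcd v π s.1 t.1 = s.1) :
    (Term.gcd v π s.1 t.1).val v = min (s.1.val v) (t.1.val v) ∧
    a.val v = t.1.val v - min (s.1.val v) (t.1.val v) ∧
    b.val v = s.1.val v - min (s.1.val v) (t.1.val v) := by
  have hd : (Term.gcd v π s.1 t.1).val v = min (s.1.val v) (t.1.val v) := ord_zpow hπ _
  have h₁ := Term.val_mul v a (Term.gcd v π s.1 t.1)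
  have h₂ := Term.val_mul v b (Term.gcd v π s.1 t.1)
  rw [ha] at h₁
  rw [hb] at h₂
  exact ⟨hd, by omega, by omega⟩

/-- The two sides of an S-polynomial have the same leading term, the least common multiple of the
two leading terms. -/
theorem mul_eq_mul_of_gcd (ha : a * Term.gcd v π s.1 t.1 = t.1)
    (hb : b * Term.gcd v π s.1 t.1 = s.1) : a * s.1 = b * t.1 := by
  refine mul_right_cancel (b := Term.gcd v π s.1 t.1) ?_
  rw [mul_right_comm, ha, mul_right_comm, hb, mul_comm]

/-- Every coincidence between multiples of two leading terms is a multiple of the one that defines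
the S-polynomial. -/
theorem exists_eq_mul_of_gcd (hπ : v (π : K) = 1) (ha : a * Term.gcd v π s.1 t.1 = t.1)
    (hb : b * Term.gcd v π s.1 t.1 = s.1) {u w : IntTerm v n} (huw : u * s = w * t) :
    ∃ c : IntTerm v n, u.1 = c.1 * a ∧ w.1 = c.1 * b := by
  obtain ⟨-, hav, hbv⟩ := val_of_mul_gcd hπ ha hb
  have huw' : u.1 * s.1 = w.1 * t.1 := congrArg Subtype.val huw
  have hva := Term.val_mul v u.1 s.1
  have hvb := Term.val_mul v w.1 t.1
  rw [huw'] at hva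
  have hu := IntTerm.val_nonneg v u
  have hw := IntTerm.val_nonneg v w
  let a' : IntTerm v n := ⟨a, show 0 ≤ a.val v by omega⟩
  have hdvd : a' ∣ u := by
    refine IntTerm.dvd_iff.mpr ⟨by change a.val v ≤ _; omega, fun k => ?_⟩
    change a.exp k ≤ _
    have h₁ : a.exp k + min (s.1.exp k) (t.1.exp k) = t.1.exp k :=
      DFunLike.congr_fun (congrArg Term.exp ha) k
    have h₂ : u.1.exp k + s.1.exp k = w.1.exp k + t.1.exp k :=
      DFunLike.congr_fun (congrArg Term.exp huw') k
    omega
  obtain ⟨c, hc⟩ := hdvd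
  have hu' : u.1 = c.1 * a := (congrArg Subtype.val hc).trans (mul_comm _ _)
  refine ⟨c, hu', mul_right_cancel (b := t.1) ?_⟩
  rw [← huw', hu', mul_assoc, mul_assoc, mul_eq_mul_of_gcd ha hb]

/-- Buchberger's condition for a pair follows from the case of its S-polynomial. -/
theorem good_of_spoly (hπ : v (π : K) = 1) (ha : a * Term.gcd v π s.1 t.1 = t.1)
    (hb : b * Term.gcd v π s.1 t.1 = s.1) {N : ℤ} {G : List (Approx v n)} {f g : Approx v n}
    (hs : f.IsLT mo s) (ht : g.IsLT mo t)
    (h : (a * s.1).val v < N → a.toSeries * f.center.1 - b.toSeries * g.center.1 ∈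
      combos mo N G fun γ => γ.Lt v mo (a * s.1)) : Good mo N G f g := by
  intro s' t' hs' ht' u w huw hval
  obtain rfl := hs.2.unique hs'.2
  obtain rfl := ht.2.unique ht'.2
  obtain ⟨c, hu, hw⟩ := exists_eq_mul_of_gcd hπ ha hb huw
  have hlcm : (u * s).1 = c.1 * (a * s.1) := by
    rw [Submonoid.coe_mul, hu, mul_assoc]
  rw [hlcm] at hval ⊢
  rw [Term.val_mul] at hval
  have hc := IntTerm.val_nonneg v c
  have := toSeries_mul_mem_combos (h (by omega)) c
  rwa [mul_sub, ← mul_assoc c.1.toSeries a.toSeries, ← mul_assoc c.1.toSeries b.toSeries,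
    ← toSeries_mul, ← toSeries_mul, ← hu, ← hw] at this

/-- The S-polynomial is smaller than the least common multiple of the leading terms. -/
theorem spoly_mem_below (ha : a * Term.gcd v π s.1 t.1 = t.1)
    (hb : b * Term.gcd v π s.1 t.1 = s.1) {f g : Approx v n}
    (hs : f.IsLT mo s) (ht : g.IsLT mo t) :
    a.toSeries * f.center.1 - b.toSeries * g.center.1 ∈ below v mo (a * s.1) := by
  have h := mul_eq_mul_of_gcd ha hb
  refine mem_below_iff.mpr ⟨sub_mem (toSeries_mul_mem_atMost hs.mem_atMost a) ?_, ?_⟩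
  · rw [h]
    exact toSeries_mul_mem_atMost ht.mem_atMost b
  · rw [map_sub, coeff_eq_of_toSeries_mul hs.coeff_eq, h, coeff_eq_of_toSeries_mul ht.coeff_eq,
      sub_self, v.map_zero]
    exact WithTop.coe_lt_top _

end SPoly

/-! ### The invariant of the algorithm -/

section Invariant

variable {K : Type*} [Field K] {v : AddValuation K (WithTop ℤ)} {n : ℕ} (π : Kˣ)
  (mo : MonomialOrder (Fin n)) (N : ℤ) (I : Ideal (IntTate v n))
  {m : ℕ} (F : Fin m → Approx v n)

/-- The invariant of the main loop: the members of `G` approximate elements of `I` at precision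
`O(π ^ N)` at least, `G` contains the input, and the pairs that are no longer in `B` satisfy
Buchberger's condition. -/
structure BasisInvariant (G : List (Approx v n)) (B : Multiset (Approx v n × Approx v n)) :
    Prop where
  input_mem : ∀ i, F i ∈ G
  approximates : ∀ g ∈ G, N ≤ g.prec ∧ ∃ x ∈ I, Cong v g.prec g.center.1 x.1
  pair_mem : ∀ p ∈ B, p.1 ∈ G ∧ p.2 ∈ G
  good : ∀ f ∈ G, ∀ g ∈ G, f = g ∨ (f, g) ∈ B ∨ (g, f) ∈ B ∨ Good mo N G f g

/-- The invariant of the division of the S-polynomial of `f` and `g`, with current dividend `h` and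
remainder `r`: modulo its precision `h + r` belongs to `I`, and modulo `O(π ^ N)` it differs from
the S-polynomial by a combination whose leading terms are smaller than the least common multiple
of those of `f` and `g`, as are `h` and `r`. -/
structure DivisionInvariant (G : List (Approx v n)) (f g h : Approx v n) (r : IntTate v n) :
    Prop where
  le_prec : N ≤ h.prec
  approximates : ∃ x ∈ I, Cong v h.prec (h.center.1 + r.1) x.1
  combination : ∃ (s t : IntTerm v n) (a b : Term K n), f.IsLT mo s ∧ g.IsLT mo t ∧
    a * Term.gcd v π s.1 t.1 = t.1 ∧ b * Term.gcd v π s.1 t.1 = s.1 ∧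
    ((a * s.1).val v < N → h.center.1 ∈ below v mo (a * s.1) ∧ r.1 ∈ below v mo (a * s.1) ∧
      a.toSeries * f.center.1 - b.toSeries * g.center.1 - (h.center.1 + r.1) ∈
        combos mo N G fun γ => γ.Lt v mo (a * s.1))

/-- The invariant of Buchberger's algorithm. -/
def State.Invariant : State v n → Prop
  | .main G B => BasisInvariant mo N I F G B
  | .division G B h r => ∃ f g, BasisInvariant mo N I F G ((f, g) ::ₘ B) ∧
      DivisionInvariant π mo N I G f g h r
  | .output G => BasisInvariant mo N I F G 0

variable {π mo N I F}

/-- Once the pair `(f, g)` satisfies Buchberger's condition, it can be forgotten. -/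
theorem BasisInvariant.good_of_good {G G' : List (Approx v n)}
    {B : Multiset (Approx v n × Approx v n)} {f g : Approx v n}
    (h : BasisInvariant mo N I F G ((f, g) ::ₘ B)) (hG : G ⊆ G') (hfg : Good mo N G' f g) :
    ∀ f' ∈ G, ∀ g' ∈ G, f' = g' ∨ (f', g') ∈ B ∨ (g', f') ∈ B ∨ Good mo N G' f' g' := by
  intro f' hf' g' hg'
  rcases h.good f' hf' g' hg' with h | h | h | h
  · exact Or.inl h
  · rcases Multiset.mem_cons.mp h with h | h
    · obtain ⟨rfl, rfl⟩ := Prod.mk.inj h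
      exact Or.inr (Or.inr (Or.inr hfg))
    · exact Or.inr (Or.inl h)
  · rcases Multiset.mem_cons.mp h with h | h
    · obtain ⟨rfl, rfl⟩ := Prod.mk.inj h
      exact Or.inr (Or.inr (Or.inr hfg.symm))
    · exact Or.inr (Or.inr (Or.inl h))
  · exact Or.inr (Or.inr (Or.inr (h.mono hG)))

theorem BasisInvariant.drop {G : List (Approx v n)} {B : Multiset (Approx v n × Approx v n)}
    {f g : Approx v n} (h : BasisInvariant mo N I F G ((f, g) ::ₘ B)) (hfg : Good mo N G f g) :
    BasisInvariant mo N I F G B :=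
  ⟨h.input_mem, h.approximates, fun p hp => h.pair_mem p (Multiset.mem_cons_of_mem hp),
    h.good_of_good (List.Subset.refl _) hfg⟩

/-- The invariant holds when a division starts. The precision of an S-polynomial is at least `N`
because the leading terms are significant at the precision of their series. -/
theorem DivisionInvariant.of_isSPoly (hπ : v (π : K) = 1) {G : List (Approx v n)}
    {f g h : Approx v n} (hf : N ≤ f.prec ∧ ∃ x ∈ I, Cong v f.prec f.center.1 x.1)
    (hg : N ≤ g.prec ∧ ∃ x ∈ I, Cong v g.prec g.center.1 x.1) (hh : IsSPoly π mo f g h) :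
    DivisionInvariant π mo N I G f g h 0 := by
  obtain ⟨s, t, a, b, hs, ht, ha, hb, hprec, hcong⟩ := hh
  obtain ⟨hd, hav, hbv⟩ := val_of_mul_gcd hπ ha hb
  obtain ⟨hfN, x, hx, hfx⟩ := hf
  obtain ⟨hgN, y, hy, hgy⟩ := hg
  have hs' := hs.val_lt
  have ht' := ht.val_lt
  rw [hd] at hprec hcong
  rw [← hprec] at hcong
  have hle : N ≤ h.prec ∧ h.prec ≤ f.prec + a.val v ∧ h.prec ≤ g.prec + b.val v := by
    rw [hprec]
    unfold mulPrec
    omega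
  obtain ⟨hN, hpa, hpb⟩ := hle
  refine ⟨hN, ?_, s, t, a, b, hs, ht, ha, hb, fun hval => ⟨?_, zero_mem _, ?_⟩⟩
  · let a' : IntTerm v n := ⟨a, show 0 ≤ a.val v by omega⟩
    let b' : IntTerm v n := ⟨b, show 0 ≤ b.val v by omega⟩
    refine ⟨IntTerm.toTate a' * x - IntTerm.toTate b' * y,
      I.sub_mem (I.mul_mem_left _ hx) (I.mul_mem_left _ hy), ?_⟩
    rw [ZeroMemClass.coe_zero, add_zero]
    exact hcong.trans (((hfx.toSeries_mul a).mono hpa).sub ((hgy.toSeries_mul b).mono hpb))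
  · rw [← sub_add_cancel h.center.1 (a.toSeries * f.center.1 - b.toSeries * g.center.1)]
    exact add_mem (negligible_le_below (hval.trans_le hN) (cong_iff.mp hcong))
      (spoly_mem_below ha hb hs ht)
  · rw [ZeroMemClass.coe_zero, add_zero]
    exact negligible_le_combos _ _ (negligible_mono hN (cong_iff.mp hcong.symm))

theorem DivisionInvariant.reduce {G : List (Approx v n)} {f₀ g₀ h h' g : Approx v n}
    {r : IntTate v n} {s t q : IntTerm v n} (hinv : DivisionInvariant π mo N I G f₀ g₀ h r)
    (hg : g ∈ G) (hgI : N ≤ g.prec ∧ ∃ x ∈ I, Cong v g.prec g.center.1 x.1)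
    (ht : h.IsLT mo t) (hs : g.IsLT mo s)
    (hq : Cong v (min h.prec (g.prec + q.1.val v)) t.1.toSeries (q * s).1.toSeries)
    (hh' : h'.Represents (h.center.1 - q.1.toSeries * g.center.1)
      (min h.prec (g.prec + q.1.val v))) :
    DivisionInvariant π mo N I G f₀ g₀ h' r := by
  obtain ⟨hN, ⟨x, hx, hhx⟩, s₀, t₀, a, b, hs₀, ht₀, ha, hb, hcomb⟩ := hinv
  obtain ⟨hgN, y, hy, hgy⟩ := hgI
  obtain ⟨h₁, h₂, h₃⟩ := val_exp_of_reduce ht hs hq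
  have hbelow := mem_below_of_reduce ht hs hq hh'
  obtain ⟨hprec, hcong⟩ := hh'
  rw [← hprec] at hcong
  have hq0 := IntTerm.val_nonneg v q
  have hN' : N ≤ h'.prec := by omega
  refine ⟨hN', ?_, s₀, t₀, a, b, hs₀, ht₀, ha, hb, fun hval => ?_⟩
  · refine ⟨x - IntTerm.toTate q * y, I.sub_mem hx (I.mul_mem_left _ hy), ?_⟩
    have h₄ := (hhx.mono (p := h'.prec) (by omega)).sub
      ((hgy.toSeries_mul q.1).mono (p := h'.prec) (by omega))
    refine (hcong.add (Cong.refl _ r.1)).trans ?_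
    rw [sub_add_eq_add_sub]
    exact h₄
  · obtain ⟨hb₁, hb₂, hc⟩ := hcomb hval
    have hlt : t.1.Lt v mo (a * s₀.1) := lt_of_mem_below hb₁ ht.coeff_eq
    refine ⟨atMost_le_below hlt (below_le_atMost _ hbelow), hb₂, ?_⟩
    have hqg : q.1.toSeries * g.center.1 ∈ combos mo N G fun γ => γ.Lt v mo (a * s₀.1) :=
      mem_combos hg hs ((Term.le_of_val_eq_of_exp_eq h₁ h₂).trans_lt hlt)
    have hneg := negligible_le_combos (mo := mo) G (fun γ => γ.Lt v mo (a * s₀.1))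
      (negligible_mono hN' (cong_iff.mp hcong))
    convert sub_mem (add_mem hc hqg) hneg using 1
    abel

theorem DivisionInvariant.move {G : List (Approx v n)} {f₀ g₀ h h' : Approx v n}
    {r r' : IntTate v n} {t : IntTerm v n} (hinv : DivisionInvariant π mo N I G f₀ g₀ h r)
    (ht : h.IsLT mo t) (hr' : Cong v h.prec r'.1 (r.1 + t.1.toSeries))
    (hh' : h'.Represents (h.center.1 - t.1.toSeries) h.prec) :
    DivisionInvariant π mo N I G f₀ g₀ h' r' := by
  obtain ⟨hN, ⟨x, hx, hhx⟩, s₀, t₀, a, b, hs₀, ht₀, ha, hb, hcomb⟩ := hinv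
  have hbelow := mem_below_of_move ht hh'
  obtain ⟨hprec, hcong⟩ := hh'
  have hsum : Cong v h.prec (h'.center.1 + r'.1) (h.center.1 + r.1) := by
    convert hcong.add hr' using 1
    abel
  refine ⟨by omega, ⟨x, hx, ?_⟩, s₀, t₀, a, b, hs₀, ht₀, ha, hb, fun hval => ?_⟩
  · rw [hprec]
    exact hsum.trans hhx
  · obtain ⟨hb₁, hb₂, hc⟩ := hcomb hval
    have hlt : t.1.Lt v mo (a * s₀.1) := lt_of_mem_below hb₁ ht.coeff_eq
    refine ⟨atMost_le_below hlt (below_le_atMost _ hbelow), ?_, ?_⟩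
    · rw [← sub_add_cancel r'.1 (r.1 + t.1.toSeries)]
      exact add_mem (negligible_le_below (hval.trans_le hN) (cong_iff.mp hr'))
        (add_mem hb₂ (atMost_le_below hlt (toSeries_mem_atMost _)))
    · have hneg := negligible_le_combos (mo := mo) G (fun γ => γ.Lt v mo (a * s₀.1))
        (negligible_mono hN (cong_iff.mp hsum))
      convert sub_mem hc hneg using 1
      abel

/-- At the end of a division, the remainder approximates an element of `I`. -/
theorem DivisionInvariant.remainder_approximates {G : List (Approx v n)} {f₀ g₀ h R : Approx v n}
    {r : IntTate v n} (hinv : DivisionInvariant π mo N I G f₀ g₀ h r) (hh : h.Vanishes)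
    (hR : R.Represents r.1 h.prec) :
    N ≤ R.prec ∧ ∃ x ∈ I, Cong v R.prec R.center.1 x.1 := by
  obtain ⟨hN, ⟨x, hx, hhx⟩, -⟩ := hinv
  obtain ⟨hprec, hcong⟩ := hR
  refine ⟨by omega, x, hx, ?_⟩
  rw [hprec]
  refine (hcong.trans ?_).trans hhx
  simpa using (Cong.symm hh).add (Cong.refl h.prec r.1)

/-- At the end of a division, the pair that gave rise to it satisfies Buchberger's condition,
as soon as the remainder vanishes or belongs to the new basis. -/
theorem DivisionInvariant.good {G G' : List (Approx v n)} {f₀ g₀ h R : Approx v n}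
    (hπ : v (π : K) = 1) {r : IntTate v n} (hinv : DivisionInvariant π mo N I G f₀ g₀ h r)
    (hh : h.Vanishes) (hR : R.Represents r.1 h.prec) (hG : G ⊆ G') (hRG : R.Vanishes ∨ R ∈ G') :
    Good mo N G' f₀ g₀ := by
  obtain ⟨hN, -, s₀, t₀, a, b, hs₀, ht₀, ha, hb, hcomb⟩ := hinv
  obtain ⟨hprec, hcong⟩ := hR
  refine good_of_spoly hπ ha hb hs₀ ht₀ fun hval => ?_
  obtain ⟨-, hb₂, hc⟩ := hcomb hval
  have hsum : h.center.1 + r.1 - R.center.1 ∈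
      combos mo N G' fun γ => γ.Lt v mo (a * s₀.1) := by
    refine negligible_le_combos _ _ (negligible_mono hN (cong_iff.mp ?_))
    simpa using hh.add hcong.symm
  have hR' : R.center.1 ∈ combos mo N G' fun γ => γ.Lt v mo (a * s₀.1) := by
    by_cases hvan : R.Vanishes
    · refine negligible_le_combos _ _ (negligible_mono ?_ (Approx.vanishes_iff.mp hvan))
      omega
    · obtain ⟨s, hs⟩ := Approx.exists_isLT (mo := mo) hvan
      have hRb : R.center.1 ∈ below v mo (a * s₀.1) := by
        rw [← sub_add_cancel R.center.1 r.1]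
        exact add_mem (negligible_le_below (hval.trans_le hN) (cong_iff.mp hcong)) hb₂
      have hone : (1 : IntTerm v n).1.toSeries = 1 := rfl
      rw [← one_mul R.center.1, ← hone]
      refine mem_combos (hRG.resolve_left hvan) hs ?_
      rw [one_mul]
      exact lt_of_mem_below hRb hs.coeff_eq
  convert add_mem (add_mem (combos_mono hG (fun _ => id) hc) hsum) hR' using 1
  abel

theorem State.Invariant.step (hπ : v (π : K) = 1) {S S' : State v n}
    (hS : S.Invariant π mo N I F) (h : Step π mo S S') : S'.Invariant π mo N I F := by
  cases h with
  | skip hfg =>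
    refine BasisInvariant.drop hS fun s t hs ht => ?_
    exact (hfg.elim hs.1 ht.1).elim
  | @spoly G B f g h hh =>
    have hfg := hS.pair_mem (f, g) (Multiset.mem_cons_self _ _)
    exact ⟨f, g, hS, DivisionInvariant.of_isSPoly hπ (hS.approximates f hfg.1)
      (hS.approximates g hfg.2) hh⟩
  | reduce hg ht hs hst hq hh' =>
    obtain ⟨f₀, g₀, hB, hD⟩ := hS
    exact ⟨f₀, g₀, hB, hD.reduce hg (hB.approximates _ hg) ht hs hq hh'⟩
  | move ht hG hr' hh' =>
    obtain ⟨f₀, g₀, hB, hD⟩ := hS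
    exact ⟨f₀, g₀, hB, hD.move ht hr' hh'⟩
  | discard hh hR hR0 =>
    obtain ⟨f₀, g₀, hB, hD⟩ := hS
    exact hB.drop (hD.good hπ hh hR (List.Subset.refl _) (Or.inl hR0))
  | @adjoin G B h R r hh hR hR0 =>
    obtain ⟨f₀, g₀, hB, hD⟩ := hS
    have hsub : G ⊆ G ++ [R] := List.subset_append_left _ _
    have hRmem : R ∈ G ++ [R] := by simp
    refine ⟨fun i => hsub (hB.input_mem i), fun g hg => ?_, fun p hp => ?_, ?_⟩
    · rcases List.mem_append.mp hg with hg | hg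
      · exact hB.approximates g hg
      · rw [List.mem_singleton.mp hg]
        exact hD.remainder_approximates hh hR
    · rcases Multiset.mem_add.mp hp with hp | hp
      · have := hB.pair_mem p (Multiset.mem_cons_of_mem hp)
        exact ⟨hsub this.1, hsub this.2⟩
      · obtain ⟨g, hg, rfl⟩ := List.mem_map.mp (Multiset.mem_coe.mp hp)
        exact ⟨hsub hg, hRmem⟩
    · have hold := hB.good_of_good hsub (hD.good hπ hh hR hsub (Or.inr hRmem))
      have hnew : ∀ g ∈ G, (g, R) ∈ B + ((G.map fun g => (g, R) :
          List (Approx v n × Approx v n)) : Multiset (Approx v n × Approx v n)) := fun g hg =>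
        Multiset.mem_add.mpr (Or.inr (Multiset.mem_coe.mpr (List.mem_map.mpr ⟨g, hg, rfl⟩)))
      intro f hf g hg
      rcases List.mem_append.mp hf with hf | hf <;> rcases List.mem_append.mp hg with hg | hg
      · rcases hold f hf g hg with h | h | h | h
        · exact Or.inl h
        · exact Or.inr (Or.inl (Multiset.mem_add.mpr (Or.inl h)))
        · exact Or.inr (Or.inr (Or.inl (Multiset.mem_add.mpr (Or.inl h))))
        · exact Or.inr (Or.inr (Or.inr h))
      · rw [List.mem_singleton.mp hg]
        exact Or.inr (Or.inl (hnew f hf))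
      · rw [List.mem_singleton.mp hf]
        exact Or.inr (Or.inr (Or.inl (hnew g hg)))
      · rw [List.mem_singleton.mp hf, List.mem_singleton.mp hg]
        exact Or.inl rfl
  | finish => exact hS

theorem State.invariant_init {f : Fin m → IntTate v n} (hf : Ideal.span (Set.range f) = I)
    (hF : ∀ i, (F i).Represents (f i).1 N) : (State.init F).Invariant π mo N I F := by
  refine ⟨fun i => (List.mem_ofFn' F (F i)).mpr ⟨i, rfl⟩, fun g hg => ?_, fun p hp => ?_, ?_⟩
  · obtain ⟨i, rfl⟩ := (List.mem_ofFn' F g).mp hg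
    refine ⟨(hF i).1.ge, f i, hf ▸ Ideal.subset_span ⟨i, rfl⟩, ?_⟩
    rw [(hF i).1]
    exact (hF i).2
  · obtain ⟨q, -, rfl⟩ := Multiset.mem_map.mp hp
    exact ⟨(List.mem_ofFn' F _).mpr ⟨q.1, rfl⟩, (List.mem_ofFn' F _).mpr ⟨q.2, rfl⟩⟩
  · have hlt : ∀ i j, i < j → (F i, F j) ∈ (Finset.univ.filter fun p : Fin m × Fin m =>
        p.1 < p.2).val.map fun p => (F p.1, F p.2) := fun i j hij =>
      Multiset.mem_map.mpr ⟨(i, j), by simpa using hij, rfl⟩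
    intro g hg g' hg'
    obtain ⟨i, rfl⟩ := (List.mem_ofFn' F g).mp hg
    obtain ⟨j, rfl⟩ := (List.mem_ofFn' F g').mp hg'
    rcases lt_trichotomy i j with h | rfl | h
    · exact Or.inr (Or.inl (hlt i j h))
    · exact Or.inl rfl
    · exact Or.inr (Or.inr (Or.inl (hlt j i h)))

theorem State.Invariant.of_reflTransGen (hπ : v (π : K) = 1) {S S' : State v n}
    (hS : S.Invariant π mo N I F) (h : Relation.ReflTransGen (Step π mo) S S') :
    S'.Invariant π mo N I F := by
  induction h with
  | refl => exact hS
  | tail _ h ih => exact ih.step hπ h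

/-- The output approximates a Gröbner basis: as the skeleton of `LT(I)` has valuation less than `N`,
Buchberger's criterion modulo `O(π ^ N)` suffices. -/
theorem BasisInvariant.exists_isGroebnerBasis {f : Fin m → IntTate v n}
    (hf : Ideal.span (Set.range f) = I) (hF : ∀ i, (F i).Represents (f i).1 N)
    (hN : ∀ t : IntTerm v n, Associates.mk t ∈ skeleton (leadingTerms v mo I) → t.1.val v < N)
    {G : List (Approx v n)} (hG : BasisInvariant mo N I F G 0) :
    ∃ g' : Fin G.length → IntTate v n,
      (∀ i, (G.get i).Represents (g' i).1 (G.get i).prec) ∧ IsGroebnerBasis v mo I g' := by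
  have hgood : ∀ f ∈ G, ∀ g ∈ G, Good mo N G f g := by
    intro f hf g hg
    rcases hG.good f hf g hg with rfl | h | h | h
    · exact good_self G f
    · exact absurd h (Multiset.notMem_zero _)
    · exact absurd h (Multiset.notMem_zero _)
    · exact h
  choose g' hg'I hg' using fun i => (hG.approximates (G.get i) (G.get_mem i)).2
  refine ⟨g', fun i => ⟨rfl, hg' i⟩, hg'I, Set.Subset.antisymm (fun t ht => ?_) ?_⟩
  · have hgen := skeleton_generates v n _ (isMonoidIdeal_leadingTerms (mo := mo) I)
    have ht' : Associates.mk t ∈ monoidSpan (skeleton (leadingTerms v mo I)) :=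
      hgen ▸ ⟨t, ht, rfl⟩
    obtain ⟨e, he, het⟩ := ht'
    obtain ⟨_, ⟨x, hxI, hx⟩, rfl⟩ := he.1
    obtain ⟨g, hg, s, hs, hsd⟩ := exists_isLT_dvd hgood
      (mem_combos_of_mem_span hF hG.input_mem (hf ▸ hxI)) hx (hN _ he)
    obtain ⟨i, rfl⟩ := List.get_of_mem hg
    obtain ⟨s', hs', h₁, h₂⟩ := hs.2.exists_of_sub_mem hs.val_lt (cong_iff.mp (hg' i))
    refine ⟨s', ⟨i, hs'⟩, dvd_trans ?_ (hsd.trans (Associates.mk_dvd_mk.mp het))⟩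
    exact IntTerm.dvd_iff.mpr ⟨h₁.le, h₂.le⟩
  · rintro _ ⟨s, ⟨i, hs⟩, c, rfl⟩
    rw [mul_comm]
    exact isMonoidIdeal_leadingTerms I c s ⟨g' i, hg'I i, hs⟩

end Invariant

/-! ### Termination -/

section Termination

variable {K : Type*} [Field K] {v : AddValuation K (WithTop ℤ)} {n : ℕ} {π : Kˣ}
  {mo : MonomialOrder (Fin n)}

/-- In a well-quasi-ordered set, ascending chains of upper sets are stationary. -/
theorem wellFoundedLT_upperSet (α : Type*) [Preorder α] [WellQuasiOrderedLE α] :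
    WellFoundedLT (UpperSet α) := by
  refine ⟨RelEmbedding.wellFounded_iff_isEmpty.mpr ⟨fun e => ?_⟩⟩
  have hlt : ∀ k, e (k + 1) < e k := fun k => e.map_rel_iff.mpr (Nat.lt_succ_self k)
  have hanti : Antitone e := antitone_nat_of_succ_le fun k => (hlt k).le
  -- a sequence of new elements would have no two comparable terms
  have hex : ∀ k, ∃ a, a ∈ e (k + 1) ∧ a ∉ e k := fun k => by
    by_contra h
    push Not at h
    exact not_le_of_gt (hlt k) fun a ha => h a ha
  choose a ha ha' using hex
  obtain ⟨k, l, hkl, hle⟩ := wellQuasiOrdered_le a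
  exact ha' l ((e l).upper hle (hanti (show k + 1 ≤ l from hkl) (ha k)))

variable (mo) in
/-- The exponents, in `ℕ × ℕ ^ n`, of the terms of the monoid ideal generated by the leading terms
of the nonvanishing members of `G`; a term `a X ^ i` has exponent `(val a, i)`,
where `val a` is nonnegative. -/
def leadingExponents (G : List (Approx v n)) : UpperSet (ℕ × (Fin n →₀ ℕ)) :=
  upperClosure {e | ∃ g ∈ G, ∃ s, g.IsLT mo s ∧ e = ((s.1.val v).toNat, s.1.exp)}

theorem leadingExponents_append_lt {G : List (Approx v n)} {R : Approx v n} {t : IntTerm v n}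
    (ht : R.IsLT mo t) (hG : ∀ g ∈ G, ∀ s, g.IsLT mo s → ¬ s ∣ t) :
    leadingExponents mo (G ++ [R]) < leadingExponents mo G := by
  refine lt_of_le_not_ge (upperClosure_anti ?_) fun h => ?_
  · rintro e ⟨g, hg, s, hs, he⟩
    exact ⟨g, List.mem_append_left _ hg, s, hs, he⟩
  · have hmem : ((t.1.val v).toNat, t.1.exp) ∈ leadingExponents mo G :=
      h (subset_upperClosure ⟨R, by simp, t, ht, rfl⟩)
    obtain ⟨_, ⟨g, hg, s, hs, rfl⟩, hle⟩ := mem_upperClosure.mp hmem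
    have h₁ : (s.1.val v).toNat ≤ (t.1.val v).toNat := hle.1
    have h₂ := IntTerm.val_nonneg v t
    exact hG g hg s hs (IntTerm.dvd_iff.mpr ⟨by omega, hle.2⟩)

variable (mo) in
/-- The terms of the remainder `r` that are significant at the current precision are greater than
those of the dividend `h` and divisible by no leading term of `G`. -/
def RemainderInvariant (G : List (Approx v n)) (h : Approx v n) (r : IntTate v n) : Prop :=
  ∀ t : IntTerm v n, MvPowerSeries.coeff t.1.exp r.1 = (t.1.1 : K) → t.1.val v < h.prec →
    h.center.1 ∈ below v mo t.1 ∧ ∀ g ∈ G, ∀ s, g.IsLT mo s → ¬ s ∣ t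

theorem RemainderInvariant.zero (G : List (Approx v n)) (h : Approx v n) :
    RemainderInvariant mo G h 0 := by
  intro t ht
  exact absurd ht.symm (by simp)

theorem RemainderInvariant.of_mem_below {G : List (Approx v n)} {h h' : Approx v n}
    {r : IntTate v n} {t : IntTerm v n} (hr : RemainderInvariant mo G h r) (ht : h.IsLT mo t)
    (hh' : h'.center.1 ∈ below v mo t.1) (hprec : h'.prec ≤ h.prec) :
    RemainderInvariant mo G h' r := by
  intro u hu huval
  obtain ⟨h₁, h₂⟩ := hr u hu (by omega)
  exact ⟨below_mono (lt_of_mem_below h₁ ht.coeff_eq).le hh', h₂⟩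

theorem RemainderInvariant.move {G : List (Approx v n)} {h h' : Approx v n}
    {r r' : IntTate v n} {t : IntTerm v n} (hr : RemainderInvariant mo G h r) (ht : h.IsLT mo t)
    (hG : ∀ g ∈ G, ∀ s : IntTerm v n, g.IsLT mo s → ¬ s ∣ t)
    (hr' : Cong v h.prec r'.1 (r.1 + t.1.toSeries))
    (hh' : h'.Represents (h.center.1 - t.1.toSeries) h.prec) :
    RemainderInvariant mo G h' r' := by
  have hbelow := mem_below_of_move ht hh'
  intro u hu huval
  rw [hh'.1] at huval
  -- the claim on `u` depends only on its valuation and exponent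
  suffices h : ∃ w : IntTerm v n, w.1.val v = u.1.val v ∧ w.1.exp = u.1.exp ∧ t.1.Le v mo w.1 ∧
      ∀ g ∈ G, ∀ s, g.IsLT mo s → ¬ s ∣ w by
    obtain ⟨w, h₁, h₂, hle, hw⟩ := h
    refine ⟨below_mono (Term.le_of_val_eq_of_exp_eq h₁ h₂) (below_mono hle hbelow),
      fun g hg s hs hd => hw g hg s hs (IntTerm.dvd_iff.mpr ?_)⟩
    rw [h₁, h₂]
    exact IntTerm.dvd_iff.mp hd
  have hi := hr' u.1.exp
  rw [map_sub, map_add, hu] at hi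
  by_cases hri : v (MvPowerSeries.coeff u.1.exp r.1) < (h.prec : WithTop ℤ)
  · -- the coefficient of `r` is significant and dominates that of `t`
    obtain ⟨w, hwexp, hw⟩ := exists_intTerm_of_coeff_ne_zero (v.ne_top_iff.mp (ne_top_of_lt hri))
    have hwval : w.1.val v < h.prec := by
      rw [hw, ← Term.coe_val] at hri
      exact WithTop.coe_lt_coe.mp hri
    obtain ⟨h₁, h₂⟩ := hr w (hwexp ▸ hw) hwval
    have hlt := lt_of_mem_below h₁ ht.coeff_eq
    refine ⟨w, ?_, hwexp, hlt.le, h₂⟩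
    have htv := (mem_below_iff.mp (atMost_le_below hlt (toSeries_mem_atMost t.1))).2
    have heq : v (u.1.1 : K) = v (w.1.1 : K) := by
      refine v.map_eq_of_lt_sub ?_
      have := v.map_lt_add ((Term.coe_val v w.1).symm.trans_lt htv)
        (((Term.coe_val v w.1).symm.trans_lt (WithTop.coe_lt_coe.mpr hwval)).trans_le hi)
      rw [hwexp] at this
      rw [hw] at this
      convert this using 2
      ring
    rw [← Term.coe_val, ← Term.coe_val] at heq
    exact (WithTop.coe_injective heq).symm
  · have heq : v (MvPowerSeries.coeff u.1.exp t.1.toSeries) = v (u.1.1 : K) := by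
      refine v.map_eq_of_lt_sub ?_
      rw [v.map_sub_swap, ← Term.coe_val]
      refine (WithTop.coe_lt_coe.mpr huval).trans_le ?_
      convert v.map_le_add hi (not_lt.mp hri) using 2
      ring
    have hexp : u.1.exp = t.1.exp := by
      by_contra hne
      rw [coeff_toSeries_of_ne hne, v.map_zero, ← Term.coe_val] at heq
      exact WithTop.top_ne_coe heq
    rw [hexp, coeff_exp_toSeries, ← Term.coe_val, ← Term.coe_val] at heq
    exact ⟨t, WithTop.coe_injective heq, hexp.symm, Or.inr ⟨rfl, le_rfl⟩, hG⟩

/-- The leading term of the remainder is divisible by no leading term of `G`. -/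
theorem RemainderInvariant.not_dvd {G : List (Approx v n)} {h R : Approx v n}
    {r : IntTate v n} (hr : RemainderInvariant mo G h r) (hR : R.Represents r.1 h.prec)
    {t : IntTerm v n} (ht : R.IsLT mo t) : ∀ g ∈ G, ∀ s, g.IsLT mo s → ¬ s ∣ t := by
  obtain ⟨hprec, hcong⟩ := hR
  have hval := ht.val_lt
  rw [hprec] at hval
  obtain ⟨w, hw, h₁, h₂⟩ := ht.2.exists_of_sub_mem hval (cong_iff.mp hcong)
  intro g hg s hs hd
  refine (hr w hw.1 (by omega)).2 g hg s hs (IntTerm.dvd_iff.mpr ?_)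
  rw [h₁, h₂]
  exact IntTerm.dvd_iff.mp hd

/-- The quantity that decreases during a division: the number of significant digits of the leading
coefficient of the dividend, then its leading exponent. -/
theorem prodLex_of_mem_below {h h' : Approx v n} {t t' : IntTerm v n} (ht : h.IsLT mo t)
    (ht' : h'.IsLT mo t') (hh' : h'.center.1 ∈ below v mo t.1) (hprec : h'.prec ≤ h.prec) :
    Prod.Lex (· < ·) (· < ·) ((h'.prec - t'.1.val v).toNat, mo.toSyn t'.1.exp)
      ((h.prec - t.1.val v).toNat, mo.toSyn t.1.exp) := by
  have h₁ := ht.val_lt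
  have h₂ := ht'.val_lt
  rw [Prod.lex_def]
  rcases lt_of_mem_below hh' ht'.coeff_eq with hlt | ⟨hval, hexp⟩
  · exact Or.inl (by dsimp only; omega)
  · by_cases heq : h'.prec = h.prec
    · exact Or.inr ⟨by dsimp only; omega, hexp⟩
    · exact Or.inl (by dsimp only; omega)

/-- A division terminates, provided that the main loop does from the states that follow it. -/
theorem acc_division {G : List (Approx v n)} {B : Multiset (Approx v n × Approx v n)}
    (hdiscard : Acc (fun S' S => Step π mo S S') (State.main G B))
    (hadjoin : ∀ R : Approx v n, leadingExponents mo (G ++ [R]) < leadingExponents mo G →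
      ∀ B', Acc (fun S' S => Step π mo S S') (State.main (G ++ [R]) B'))
    (h : Approx v n) (r : IntTate v n) (hr : RemainderInvariant mo G h r) :
    Acc (fun S' S => Step π mo S S') (State.division G B h r) := by
  have hvan : ∀ (h : Approx v n) (r : IntTate v n), RemainderInvariant mo G h r → h.Vanishes →
      Acc (fun S' S => Step π mo S S') (State.division G B h r) := by
    intro h r hr hh
    refine Acc.intro _ fun S' hS' => ?_
    cases hS' with
    | reduce hg ht => exact absurd hh ht.1
    | move ht => exact absurd hh ht.1
    | discard => exact hdiscard
    | adjoin hh hR hR0 =>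
      obtain ⟨t, ht⟩ := Approx.exists_isLT (mo := mo) hR0
      exact hadjoin _ (leadingExponents_append_lt ht (hr.not_dvd hR ht)) _
  by_cases hh : h.Vanishes
  · exact hvan h r hr hh
  obtain ⟨t, ht⟩ := Approx.exists_isLT (mo := mo) hh
  have hwf : WellFounded (Prod.Lex (· < ·) (· < ·) : ℕ × mo.syn → ℕ × mo.syn → Prop) :=
    WellFounded.prod_lex wellFounded_lt wellFounded_lt
  induction hk : ((h.prec - t.1.val v).toNat, mo.toSyn t.1.exp) using hwf.induction
    generalizing h r t with
  | _ k ih =>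
  subst hk
  have hnext : ∀ (h' : Approx v n) (r' : IntTate v n), RemainderInvariant mo G h' r' →
      h'.center.1 ∈ below v mo t.1 → h'.prec ≤ h.prec →
      Acc (fun S' S => Step π mo S S') (State.division G B h' r') := by
    intro h' r' hr' hbelow hprec
    by_cases hh' : h'.Vanishes
    · exact hvan h' r' hr' hh'
    · obtain ⟨t', ht'⟩ := Approx.exists_isLT (mo := mo) hh'
      exact ih _ (prodLex_of_mem_below ht ht' hbelow hprec) h' r' hr' hh' t' ht' rfl
  refine Acc.intro _ fun S' hS' => ?_
  cases hS' with
  | reduce hg ht₁ hs hst hq hh' =>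
    obtain rfl := ht.2.unique ht₁.2
    have hbelow := mem_below_of_reduce ht hs hq hh'
    have hprec := hh'.1.trans_le (min_le_left _ _)
    exact hnext _ _ (hr.of_mem_below ht hbelow hprec) hbelow hprec
  | move ht₁ hG hr' hh' =>
    obtain rfl := ht.2.unique ht₁.2
    exact hnext _ _ (hr.move ht hG hr' hh') (mem_below_of_move ht hh') hh'.1.le
  | discard hh' => exact absurd hh' hh
  | adjoin hh' => exact absurd hh' hh

/-- The main loop terminates: each remainder enlarges the monoid ideal generated by the leading
terms, and between two of them the number of pairs decreases. -/
theorem acc_main (G : List (Approx v n)) (B : Multiset (Approx v n × Approx v n)) :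
    Acc (fun S' S => Step π mo S S') (State.main G B) := by
  induction hU : leadingExponents mo G using
    (wellFoundedLT_upperSet (ℕ × (Fin n →₀ ℕ))).wf.induction generalizing G B with
  | _ U ihU =>
  subst hU
  induction hB : B.card using Nat.strong_induction_on generalizing B with
  | _ k ihB =>
  subst hB
  refine Acc.intro _ fun S' hS' => ?_
  cases hS' with
  | skip => exact ihB _ (by simp) _ rfl
  | spoly =>
    exact acc_division (ihB _ (by simp) _ rfl) (fun R hR B' => ihU _ hR _ B' rfl) _ _
      (RemainderInvariant.zero _ _)
  | finish => exact Acc.intro _ fun S'' hS'' => by cases hS''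

end Termination

/-! ### Absence of blocking -/

section Progress

variable {K : Type*} [Field K] {v : AddValuation K (WithTop ℤ)} {n : ℕ} {π : Kˣ}
  {mo : MonomialOrder (Fin n)}

theorem exists_isSPoly (hπ : v (π : K) = 1) {f g : Approx v n} (hf : ¬ f.Vanishes)
    (hg : ¬ g.Vanishes) : ∃ h, IsSPoly π mo f g h := by
  obtain ⟨s, hs⟩ := Approx.exists_isLT (mo := mo) hf
  obtain ⟨t, ht⟩ := Approx.exists_isLT (mo := mo) hg
  have hex : ∀ u d : Term K n, d.exp ≤ u.exp → ∃ a : Term K n, a * d = u := fun u d h =>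
    ⟨(u.1 / d.1, Multiplicative.ofAdd (u.exp - d.exp)),
      Prod.ext (div_mul_cancel _ _) (tsub_add_cancel_of_le h)⟩
  obtain ⟨a, ha⟩ := hex t.1 (Term.gcd v π s.1 t.1) inf_le_right
  obtain ⟨b, hb⟩ := hex s.1 (Term.gcd v π s.1 t.1) inf_le_left
  obtain ⟨-, hav, hbv⟩ := val_of_mul_gcd hπ ha hb
  let a' : IntTerm v n := ⟨a, show 0 ≤ a.val v by omega⟩
  let b' : IntTerm v n := ⟨b, show 0 ≤ b.val v by omega⟩
  exact ⟨⟨IntTerm.toTate a' * f.center - IntTerm.toTate b' * g.center, _⟩, s, t, a, b, hs, ht,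
    ha, hb, rfl, Cong.refl _ _⟩

theorem exists_step_or_output (hπ : v (π : K) = 1) (S : State v n) :
    (∃ S', Step π mo S S') ∨ ∃ G, S = State.output G := by
  rcases S with ⟨G, B⟩ | ⟨G, B, h, r⟩ | G
  · left
    induction B using Multiset.induction with
    | empty => exact ⟨_, Step.finish⟩
    | cons p B _ =>
      obtain ⟨f, g⟩ := p
      by_cases hfg : f.Vanishes ∨ g.Vanishes
      · exact ⟨_, Step.skip hfg⟩
      · push Not at hfg
        obtain ⟨h, hh⟩ := exists_isSPoly (mo := mo) hπ hfg.1 hfg.2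
        exact ⟨_, Step.spoly hh⟩
  · left
    by_cases hh : h.Vanishes
    · have hR : (⟨r, h.prec⟩ : Approx v n).Represents r.1 h.prec := ⟨rfl, Cong.refl _ _⟩
      by_cases hR0 : (⟨r, h.prec⟩ : Approx v n).Vanishes
      · exact ⟨_, Step.discard hh hR hR0⟩
      · exact ⟨_, Step.adjoin hh hR hR0⟩
    · obtain ⟨t, ht⟩ := Approx.exists_isLT (mo := mo) hh
      by_cases hdiv : ∃ g ∈ G, ∃ s, g.IsLT mo s ∧ s ∣ t
      · obtain ⟨g, hg, s, hs, hst⟩ := hdiv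
        obtain ⟨q, hq⟩ := hst
        refine ⟨_, Step.reduce (q := q) (h' := ⟨h.center - IntTerm.toTate q * g.center, _⟩)
          hg ht hs ⟨q, hq⟩ ?_ ⟨rfl, Cong.refl _ _⟩⟩
        rw [hq, mul_comm]
        exact Cong.refl _ _
      · push Not at hdiv
        exact ⟨_, Step.move (h' := ⟨h.center - IntTerm.toTate t, _⟩) (r' := r + IntTerm.toTate t)
          ht hdiv (Cong.refl _ _) ⟨rfl, Cong.refl _ _⟩⟩
  · exact Or.inr ⟨G, rfl⟩

end Progress

end TateGB

theorem mainTheorem3 {K : Type*} [Field K] (v : AddValuation K (WithTop ℤ))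
    (hv : TateGB.IsCompleteFor v) (π : Kˣ) (hπ : v (π : K) = 1) {n : ℕ}
    (mo : MonomialOrder (Fin n)) (I : Ideal (TateGB.IntTate v n)) {m : ℕ}
    (f : Fin m → TateGB.IntTate v n) (hf : Ideal.span (Set.range f) = I) (N : ℤ)
    (hN : ∀ t : TateGB.IntTerm v n,
      Associates.mk t ∈ TateGB.skeleton (TateGB.leadingTerms v mo I) → t.1.val v < N)
    (F : Fin m → TateGB.Approx v n) (hF : ∀ i, (F i).Represents (f i).1 N) :
    -- every run of the algorithm terminates
    Acc (fun S' S => TateGB.Step π mo S S') (TateGB.State.init F) ∧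
    -- no run gets stuck before it outputs a result
    (∀ S, Relation.ReflTransGen (TateGB.Step π mo) (TateGB.State.init F) S →
      (∃ S', TateGB.Step π mo S S') ∨ ∃ G, S = TateGB.State.output G) ∧
    -- every output is known at precision `O(π ^ N)` and approximates a Gröbner basis of `I`
    (∀ G, Relation.ReflTransGen (TateGB.Step π mo) (TateGB.State.init F)
        (TateGB.State.output G) →
      (∀ g ∈ G, N ≤ g.prec) ∧
      ∃ g' : Fin G.length → TateGB.IntTate v n,
        (∀ i, (G.get i).Represents (g' i).1 (G.get i).prec) ∧
        TateGB.IsGroebnerBasis v mo I g') := by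
  refine ⟨TateGB.acc_main _ _, fun S _ => TateGB.exists_step_or_output hπ S, fun G hG => ?_⟩
  have hinv : TateGB.BasisInvariant mo N I F G 0 :=
    (TateGB.State.invariant_init (π := π) (mo := mo) hf hF).of_reflTransGen hπ hG
  exact ⟨fun g hg => (hinv.approximates g hg).1, hinv.exists_isGroebnerBasis hf hF hN⟩
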